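/- Let $p$ be an odd prime and $L=\frac{p-1}{2}$. Let $\Gamma_0(p)\subset SL(2,\mathbb Z)$ act on the Riemann sphere $\mathbb C\cup\{\infty\}$ by Möbius transformations, write $z\sim w$ if $w=\gamma z$ for some $\gamma\in\Gamma_0(p)$, and let $\sigma z=-\bar z$, $\sigma\infty=\infty$. For a set $D$ of points of the upper half-plane $\mathbb H$ and cusps put $$\mathrm{Fix}(\sigma;D)=\{z\in D:\ \sigma z\sim z\}.$$ Let $\mathcal F=\{x+iy\in\mathbb H: |x|\le\frac12,\ x^2+y^2\ge1\}\cup\{\infty\}$, let $\alpha_l=\begin{pmatrix}0&-1\\1&-l\end{pmatrix}$ and $c_l=\alpha_l\bigl(-\frac12+i\frac{\sqrt3}{2}\bigr)$ for $l\in\mathbb Z$, and let $$\mathbb X_p=\mathcal F\cup\bigcup_{|l|\le L}\alpha_l\mathcal F .$$ Let $\widetilde{\mathbb X_p}$ be the quotient of $\mathbb X_p$ (with the topology induced from the sphere) by the relation $\sim$, and let $\mathrm{Fix}(\sigma;\widetilde{\mathbb X_p})$ be the image of $\mathrm{Fix}(\sigma;\mathbb X_p)$ in it. Finally let $\delta^{(p)}$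 be the set of points of $\mathrm{Fix}(\sigma;\mathbb X_p)$ with non-negative real part, where $\infty$ is included. Then: (i) $\delta^{(p)}$ is a simple curve from $c_L$ to $c_1$ (a path that does not meet itself, except that its end points coincide when $p=3$). It is the union of three hyperbolic geodesic arcs: the imaginary axis joining the cusps $0$ and $\infty$, the arc joining the cusp $0$ and $c_L$, and the vertical segment on $\Re z=\frac12$ joining $c_1$ and the cusp $\infty$. Moreover $\mathrm{Fix}(\sigma;\mathbb X_p)=\delta^{(p)}\cup\sigma\delta^{(p)}$. (ii) $\mathrm{Fix}(\sigma;\widetilde{\mathbb X_p})$ is a simple closed curve containing the cusp $\infty$. It is $\delta^{(p)}$ after gluing $c_L$ with $c_1$: it is the image of $\delta^{(p)}$, one has $c_L\sim c_1$, and two different points of $\delta^{(p)}$ are equivalent modulo $\Gamma_0(p)$ only if they are $c_L$ and $c_1$. (iii) Modulo $\Gamma_0(p)$, the set $\mathrm{Fix}(\sigma;\mathbb H)$ is the union of the two complete geodesics $\Re z=0$ (with end points $0,\infty$) and $\Re z=\frac12$ (with end points $\frac12,\infty$). These are inequivalent; in fact no two different points of their union are equivalent modulo $\Gamma_0(p)$.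 Their end points $0$ and $\frac12$ are equivalent modulo $\Gamma_0(p)$. -/

import Mathlib

open Set Filter Topology
open scoped Modular MatrixGroups UpperHalfPlane OnePoint

noncomputable section

namespace GammaZeroFix

/-- The Riemann sphere. It contains the upper half-plane and all the cusps; near the two cusps of
the domain `Xp` below, the subspace topology that `Xp` gets from the sphere is the same as the one
coming from horoball neighbourhoods, since `Xp` is a finite union of ideal triangles. -/
abbrev Sphere : Type := OnePoint ℂ

/-- The inclusion of the upper half-plane in the sphere. -/
def ofUHP (z : ℍ) : Sphere := ((z : ℂ) : OnePoint ℂ)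

/-- The action of `SL(2, ℤ)` on the sphere by Möbius transformations. -/
def moeb (γ : SL(2, ℤ)) (z : Sphere) : Sphere := Matrix.SpecialLinearGroup.mapGL ℂ γ • z

/-- The reflection `z ↦ -conj z`, which fixes the point at infinity. -/
def sigma : Sphere → Sphere := OnePoint.map fun z : ℂ => -(starRingEnd ℂ) z

/-- Equivalence of points of the sphere modulo `Γ`. -/
def orbitSetoid (Γ : Subgroup SL(2, ℤ)) : Setoid Sphere where
  r z w := ∃ γ ∈ Γ, moeb γ z = w
  iseqv :=
    { refl := fun z => ⟨1, Γ.one_mem, by simp [moeb]⟩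
      symm := by
        rintro z _ ⟨γ, hγ, rfl⟩
        exact ⟨γ⁻¹, Γ.inv_mem hγ, by simp only [moeb, smul_smul, ← map_mul]; simp⟩
      trans := by
        rintro z _ _ ⟨γ, hγ, rfl⟩ ⟨γ', hγ', rfl⟩
        exact ⟨γ' * γ, Γ.mul_mem hγ' hγ, by simp only [moeb, smul_smul, ← map_mul]⟩ }

/-- `Equiv₀ p z w`: the points `z` and `w` are equivalent modulo `Γ₀(p)`. -/
def Equiv₀ (p : ℕ) (z w : Sphere) : Prop := orbitSetoid (CongruenceSubgroup.Gamma0 p) z w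

/-- The points of `D` that are fixed by the reflection modulo `Γ`. -/
def fixSet (Γ : Subgroup SL(2, ℤ)) (D : Set Sphere) : Set Sphere :=
  {z | z ∈ D ∧ ∃ γ ∈ Γ, sigma z = moeb γ z}

/-- The closed standard domain `|Re z| ≤ 1/2`, `|z| ≥ 1` of the modular group, together with its
cusp at infinity. -/
def standardF : Set Sphere := insert ∞ (ofUHP '' ModularGroup.fd)

/-- The matrix `α_l = S T^(-l)`. -/
def alpha (l : ℤ) : SL(2, ℤ) := ⟨!![0, -1; 1, -l], by simp [Matrix.det_fin_two]⟩

/-- The point `1/2 + i √3/2`. -/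
def rho : Sphere := ((⟨1 / 2, Real.sqrt 3 / 2⟩ : ℂ) : OnePoint ℂ)

/-- The vertex `c_l`, the image of `-1/2 + i √3/2` under `α_l`. -/
def vertex (l : ℤ) : Sphere := moeb (alpha l) (sigma rho)

/-- The symmetric closed domain for `Γ₀(p)` (with its cusps): the union of the standard domain `F`
and of its images `α_l F` for `|l| ≤ (p - 1) / 2`. -/
def Xp (p : ℕ) : Set Sphere :=
  standardF ∪ ⋃ l ∈ {l : ℤ | |l| ≤ ((p : ℤ) - 1) / 2}, moeb (alpha l) '' standardF

/-- The part of the domain with non-negative real part; the cusp at infinity belongs to it. -/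
def XpPlus (p : ℕ) : Set Sphere := {z | z ∈ Xp p ∧ ∀ w : ℂ, z = (w : OnePoint ℂ) → 0 ≤ w.re}

/-- The points with non-negative real part in the domain that are fixed modulo `Γ₀(p)`. -/
def delta (p : ℕ) : Set Sphere := fixSet (CongruenceSubgroup.Gamma0 p) (XpPlus p)

/-- Two points of the domain are identified if they are equivalent modulo `Γ₀(p)`. -/
def gluing (p : ℕ) : Setoid (Xp p) :=
  (orbitSetoid (CongruenceSubgroup.Gamma0 p)).comap Subtype.val

/-- The symmetric standard fundamental domain: the surface obtained from `Xp` by identifying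
equivalent points, with the quotient topology. -/
def XpTilde (p : ℕ) : Type := Quotient (gluing p)

instance (p : ℕ) : TopologicalSpace (XpTilde p) :=
  inferInstanceAs (TopologicalSpace (Quotient (gluing p)))

/-- The projection of `Xp` onto the glued surface. -/
def proj (p : ℕ) (z : Xp p) : XpTilde p := Quotient.mk (gluing p) z

/-- The set of points of the glued surface that come from the points of `D`. -/
def glue (p : ℕ) (D : Set Sphere) : Set (XpTilde p) := {x | ∃ z : Xp p, (z : Sphere) ∈ D ∧ proj p z = x}

/-- The fixed set of the reflection on the glued surface. -/
def fixTilde (p : ℕ) : Set (XpTilde p) :=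
  glue p (fixSet (CongruenceSubgroup.Gamma0 p) (Xp p))

/-- A simple closed curve: the image of an embedding of the circle. -/
def IsSimpleClosedCurve {X : Type*} [TopologicalSpace X] (C : Set X) : Prop :=
  ∃ f : Circle → X, IsEmbedding f ∧ range f = C

/-- `C` is a simple curve from `a` to `b`: it is traced by a path that takes no value twice, except
that its end points are allowed to coincide. -/
def IsSimpleCurve {X : Type*} [TopologicalSpace X] (a b : X) (C : Set X) : Prop :=
  ∃ h : Path a b, range h = C ∧
    ∀ s t : unitInterval, s < t → h s = h t → s = 0 ∧ t = 1

/-- `A` is the hyperbolic geodesic arc from `a` to `b` (including its end points, each of which may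
be in the upper half-plane or on its boundary): it is traced by an injective path that stays in the
upper half-plane between its end points and along which the hyperbolic distance is additive. -/
def IsGeodesicArc (a b : Sphere) (A : Set Sphere) : Prop :=
  ∃ h : Path a b, Function.Injective h ∧ range h = A ∧
    (∀ t : unitInterval, 0 < t → t < 1 → h t ∈ range ofUHP) ∧
    ∀ (s t u : unitInterval) (x y z : ℍ), s ≤ t → t ≤ u →
      h s = ofUHP x → h t = ofUHP y → h u = ofUHP z → dist x z = dist x y + dist y z

/-- `l` is a complete hyperbolic geodesic (a subset of the upper half-plane) with end points `a` and
`b` on the boundary. -/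
def IsCompleteGeodesic (a b : Sphere) (l : Set Sphere) : Prop :=
  ∃ f : ℝ → ℍ, Isometry f ∧ range (ofUHP ∘ f) = l ∧
    Tendsto (ofUHP ∘ f) atBot (𝓝 a) ∧ Tendsto (ofUHP ∘ f) atTop (𝓝 b)

/-- The line `Re z = r` in the upper half-plane. -/
def verticalLine (r : ℝ) : Set Sphere := ofUHP '' {z : ℍ | z.re = r}

/-- The class of a point modulo `Γ₀(p)`. -/
def orbitMap (p : ℕ) : Sphere → Quotient (orbitSetoid (CongruenceSubgroup.Gamma0 p)) :=
  Quotient.mk _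

end GammaZeroFix

end

/-!
If `γ z = σ z` with `z ∈ ℍ` and `γ ∈ Γ₀(p)`, then the two diagonal entries of `γ` are equal, to `a`
say, and `a² ≡ 1` modulo `p`. As `p` is an odd prime power, it divides `a - 1` or `a + 1`, and this
makes an end point of the geodesic fixed by `γ⁻¹ σ` a cusp equivalent to `∞`. So `z` is equivalent
to a point of `Re z = 0` or of `Re z = 1 / 2`.

On the triangles `α_l F` the coordinate `w = S z` is used, where `S z = -1 / z`: the fixed points
there lie on the imaginary axis, on `Re z = ± 1 / 2`, or on the arc `Re w = ± p / 2`. The matrix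
`(L, -1; p, -2)` of `Γ₀(p)`, where `p = 2 L + 1`, maps the arc from `0` to `c_L` onto the part of
`Re z = 1 / 2` below `c_1`. No two points of `Re z = 0` and `Re z = 1 / 2` are equivalent, so `c_L`
and `c_1` are the only points of `δ` which are identified. A closed part of `δ` has a closed
saturation in `Xp`, so that the quotient topology makes the glued curve an embedded circle.
-/

namespace GammaZeroFix

open ModularGroup (S T)
open UpperHalfPlane (J)

/-! ### The action on the sphere and on the upper half-plane -/

lemma det_eq_one (γ : SL(2, ℤ)) : γ 0 0 * γ 1 1 - γ 0 1 * γ 1 0 = 1 := by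
  rw [← Matrix.det_fin_two, γ.det_coe]

lemma moeb_infty (γ : SL(2, ℤ)) :
    moeb γ ∞ = if γ 1 0 = 0 then ∞ else (((γ 0 0 : ℂ) / γ 1 0 : ℂ) : OnePoint ℂ) := by
  simp [moeb, OnePoint.smul_infty_eq_ite]

lemma moeb_coe (γ : SL(2, ℤ)) (z : ℂ) :
    moeb γ (z : OnePoint ℂ) = if (γ 1 0 : ℂ) * z + γ 1 1 = 0 then ∞ else
      ((((γ 0 0 : ℂ) * z + γ 0 1) / ((γ 1 0 : ℂ) * z + γ 1 1) : ℂ) : OnePoint ℂ) := by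
  simp [moeb, OnePoint.smul_some_eq_ite]

lemma moeb_mul (γ γ' : SL(2, ℤ)) (z : Sphere) : moeb (γ * γ') z = moeb γ (moeb γ' z) := by
  simp only [moeb, smul_smul, ← map_mul]

lemma moeb_inv_moeb (γ : SL(2, ℤ)) (z : Sphere) : moeb γ⁻¹ (moeb γ z) = z := by
  rw [← moeb_mul, inv_mul_cancel, moeb, map_one, one_smul]

lemma moeb_injective (γ : SL(2, ℤ)) : Function.Injective (moeb γ) :=
  Function.LeftInverse.injective (moeb_inv_moeb γ)

lemma ofUHP_injective : Function.Injective ofUHP := fun _ _ h ↦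
  UpperHalfPlane.ext (OnePoint.coe_injective h)

lemma ofUHP_ne_infty (z : ℍ) : ofUHP z ≠ ∞ := OnePoint.coe_ne_infty _

lemma ofUHP_ne_ofReal (z : ℍ) (x : ℝ) : ofUHP z ≠ ((x : ℂ) : OnePoint ℂ) := fun h ↦
  z.im_ne_zero <| by simpa using congrArg Complex.im (OnePoint.coe_injective h)

lemma denom_ne_zero (γ : SL(2, ℤ)) (z : ℍ) : (γ 1 0 : ℂ) * z + γ 1 1 ≠ 0 := by
  simpa [UpperHalfPlane.denom] using
    UpperHalfPlane.denom_ne_zero (Matrix.SpecialLinearGroup.mapGL ℝ γ) z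

lemma coe_smul (γ : SL(2, ℤ)) (z : ℍ) :
    ((γ • z : ℍ) : ℂ) = ((γ 0 0 : ℂ) * z + γ 0 1) / ((γ 1 0 : ℂ) * z + γ 1 1) := by
  rw [UpperHalfPlane.coe_specialLinearGroup_apply]
  simp

lemma moeb_ofUHP (γ : SL(2, ℤ)) (z : ℍ) : moeb γ (ofUHP z) = ofUHP (γ • z) := by
  rw [ofUHP, moeb_coe, if_neg (denom_ne_zero γ z), ofUHP, coe_smul]

lemma moeb_eq_ofUHP_iff {γ : SL(2, ℤ)} {s : Sphere} {z : ℍ} :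
    moeb γ s = ofUHP z ↔ s = ofUHP (γ⁻¹ • z) := by
  rw [← (moeb_injective γ).eq_iff (a := s), moeb_ofUHP, smul_inv_smul]

lemma smul_eq_iff (γ : SL(2, ℤ)) (z w : ℍ) : γ • z = w ↔
    γ 0 0 * z.re + γ 0 1 = w.re * (γ 1 0 * z.re + γ 1 1) - w.im * (γ 1 0 * z.im) ∧
    γ 0 0 * z.im = w.re * (γ 1 0 * z.im) + w.im * (γ 1 0 * z.re + γ 1 1) := by
  rw [UpperHalfPlane.ext_iff, coe_smul, div_eq_iff (denom_ne_zero γ z), Complex.ext_iff]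
  simp

lemma re_S_smul (z : ℍ) : (S • z).re = -z.re / (z.re ^ 2 + z.im ^ 2) := by
  rw [UpperHalfPlane.modular_S_smul]
  simp [Complex.normSq_apply, sq, neg_div]

lemma im_S_smul (z : ℍ) : (S • z).im = z.im / (z.re ^ 2 + z.im ^ 2) := by
  rw [UpperHalfPlane.modular_S_smul]
  simp [Complex.normSq_apply, sq, neg_div]

lemma S_smul_S_smul (z : ℍ) : S • S • z = z := by
  rw [UpperHalfPlane.modular_S_smul, UpperHalfPlane.modular_S_smul]
  ext
  simp

lemma re_sq_add_im_sq_pos (z : ℍ) : 0 < z.re ^ 2 + z.im ^ 2 :=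
  add_pos_of_nonneg_of_pos (sq_nonneg _) (pow_pos z.im_pos 2)

lemma mem_Gamma0_iff {p : ℕ} {γ : SL(2, ℤ)} :
    γ ∈ CongruenceSubgroup.Gamma0 p ↔ (p : ℤ) ∣ γ 1 0 := by
  rw [CongruenceSubgroup.Gamma0_mem, ZMod.intCast_zmod_eq_zero_iff_dvd]

lemma T_zpow_mem_Gamma0 (p : ℕ) (n : ℤ) : T ^ n ∈ CongruenceSubgroup.Gamma0 p := by
  simp [ModularGroup.coe_T_zpow]

/-! ### The reflection -/

lemma sigma_infty : sigma ∞ = ∞ := rfl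

lemma sigma_coe (z : ℂ) :
    sigma (z : OnePoint ℂ) = ((-(starRingEnd ℂ) z : ℂ) : OnePoint ℂ) := rfl

lemma sigma_zero : sigma ((0 : ℂ) : OnePoint ℂ) = ((0 : ℂ) : OnePoint ℂ) := by
  rw [sigma_coe, map_zero, neg_zero]

lemma sigma_involutive : Function.Involutive sigma := by
  intro z
  induction z using OnePoint.rec with
  | infty => rfl
  | coe z => simp only [sigma_coe, map_neg, Complex.conj_conj, neg_neg]

lemma continuous_sigma : Continuous sigma := by
  refine OnePoint.continuous_map (by fun_prop) ?_
  rw [coclosedCompact_eq_cocompact]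
  exact (Homeomorph.neg ℂ).isClosedEmbedding.tendsto_cocompact.comp
    Complex.conjLIE.toHomeomorph.isClosedEmbedding.tendsto_cocompact

lemma re_J_smul (z : ℍ) : (J • z).re = -z.re := by
  simpa using congrArg Complex.re (UpperHalfPlane.coe_J_smul z)

lemma im_J_smul (z : ℍ) : (J • z).im = z.im := by
  simpa using congrArg Complex.im (UpperHalfPlane.coe_J_smul z)

lemma sigma_ofUHP (z : ℍ) : sigma (ofUHP z) = ofUHP (J • z) := by
  rw [ofUHP, sigma_coe, ofUHP, UpperHalfPlane.coe_J_smul]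

/-- The conjugate `σ γ σ` of an integral matrix by the reflection `σ`. -/
def reflectConj (γ : SL(2, ℤ)) : SL(2, ℤ) :=
  ⟨!![γ 0 0, -γ 0 1; -γ 1 0, γ 1 1], by simpa [Matrix.det_fin_two] using det_eq_one γ⟩

lemma sigma_moeb (γ : SL(2, ℤ)) (z : Sphere) :
    sigma (moeb γ z) = moeb (reflectConj γ) (sigma z) := by
  induction z using OnePoint.rec with
  | infty =>
    rw [sigma_infty, moeb_infty, moeb_infty]
    by_cases h : γ 1 0 = 0
    · simp [reflectConj, h, sigma_infty]
    · simp [reflectConj, h, sigma_coe, div_neg]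
  | coe z =>
    have hdenom : ((reflectConj γ 1 0 : ℤ) : ℂ) * -(starRingEnd ℂ) z + (reflectConj γ 1 1 : ℤ)
        = (starRingEnd ℂ) ((γ 1 0 : ℂ) * z + γ 1 1) := by
      simp [reflectConj]
    have hnum : ((reflectConj γ 0 0 : ℤ) : ℂ) * -(starRingEnd ℂ) z + (reflectConj γ 0 1 : ℤ)
        = -(starRingEnd ℂ) ((γ 0 0 : ℂ) * z + γ 0 1) := by
      simp [reflectConj, add_comm]
    rw [sigma_coe, moeb_coe, moeb_coe, hdenom, hnum, apply_ite sigma, sigma_infty, sigma_coe,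
      map_div₀, neg_div]
    simp only [map_eq_zero]

lemma reflectConj_mem_Gamma0 {p : ℕ} {γ : SL(2, ℤ)} (h : γ ∈ CongruenceSubgroup.Gamma0 p) :
    reflectConj γ ∈ CongruenceSubgroup.Gamma0 p := by
  rw [mem_Gamma0_iff] at h ⊢
  simpa [reflectConj] using h

lemma J_smul_smul (γ : SL(2, ℤ)) (z : ℍ) : J • γ • z = reflectConj γ • J • z := by
  apply ofUHP_injective
  rw [← sigma_ofUHP, ← moeb_ofUHP, ← moeb_ofUHP, sigma_moeb, sigma_ofUHP]

lemma smul_eq_J_smul_iff (γ : SL(2, ℤ)) (z : ℍ) : γ • z = J • z ↔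
    γ 0 0 = γ 1 1 ∧ (γ 1 0 : ℝ) * (z.re ^ 2 + z.im ^ 2) + 2 * γ 0 0 * z.re + γ 0 1 = 0 := by
  rw [smul_eq_iff, re_J_smul, im_J_smul]
  constructor
  · rintro ⟨hre, him⟩
    have had : (γ 0 0 : ℝ) = γ 1 1 := mul_right_cancel₀ z.im_ne_zero (by linarith)
    exact ⟨mod_cast had, by rw [← had] at hre; linarith⟩
  · rintro ⟨had, h⟩
    rw [← had]
    constructor <;> linarith

/-! ### Equivalence modulo `Γ₀(p)` -/

section
variable {p : ℕ}

lemma equiv₀_iff {z w : Sphere} :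
    Equiv₀ p z w ↔ ∃ γ ∈ CongruenceSubgroup.Gamma0 p, moeb γ z = w := Iff.rfl

lemma Equiv₀.refl (z : Sphere) : Equiv₀ p z z := (orbitSetoid _).refl z

lemma Equiv₀.symm {z w : Sphere} (h : Equiv₀ p z w) : Equiv₀ p w z := (orbitSetoid _).symm h

lemma Equiv₀.trans {z w v : Sphere} (h : Equiv₀ p z w) (h' : Equiv₀ p w v) : Equiv₀ p z v :=
  (orbitSetoid _).trans h h'

lemma Equiv₀.sigma {z w : Sphere} (h : Equiv₀ p z w) : Equiv₀ p (sigma z) (sigma w) := by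
  obtain ⟨γ, hγ, rfl⟩ := h
  exact ⟨reflectConj γ, reflectConj_mem_Gamma0 hγ, (sigma_moeb γ z).symm⟩

lemma Equiv₀.fixed {z w : Sphere} (h : Equiv₀ p z w)
    (hw : Equiv₀ p w (GammaZeroFix.sigma w)) : Equiv₀ p z (GammaZeroFix.sigma z) :=
  (h.trans hw).trans h.sigma.symm

lemma mem_fixSet_iff {D : Set Sphere} {z : Sphere} :
    z ∈ fixSet (CongruenceSubgroup.Gamma0 p) D ↔ z ∈ D ∧ Equiv₀ p z (sigma z) := by
  simp only [fixSet, mem_ofPred_eq, equiv₀_iff, eq_comm]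

lemma equiv₀_ofUHP_iff {z w : ℍ} :
    Equiv₀ p (ofUHP z) (ofUHP w) ↔ ∃ γ ∈ CongruenceSubgroup.Gamma0 p, γ • z = w := by
  simp only [equiv₀_iff, moeb_ofUHP, ofUHP_injective.eq_iff]

lemma equiv₀_sigma_iff {z : ℍ} : Equiv₀ p (ofUHP z) (sigma (ofUHP z)) ↔
    ∃ γ ∈ CongruenceSubgroup.Gamma0 p, γ • z = J • z := by
  rw [sigma_ofUHP, equiv₀_ofUHP_iff]

lemma equiv₀_sigma_of_two_mul_re {z : ℍ} {n : ℤ} (h : 2 * z.re = n) :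
    Equiv₀ p (ofUHP z) (sigma (ofUHP z)) := by
  refine equiv₀_sigma_iff.2 ⟨T ^ (-n), T_zpow_mem_Gamma0 p _, (smul_eq_J_smul_iff _ z).2 ?_⟩
  simp [ModularGroup.coe_T_zpow, ← h]

end

/-! ### Points fixed modulo `Γ₀(p)` and vertical lines -/

section
variable {p : ℕ}

lemma cross_terms_of_smul_eq {γ : SL(2, ℤ)} {z w : ℍ} (h : γ • z = w) :
    (2 * γ 0 0 - 2 * w.re * γ 1 0) * (2 * γ 1 1 + 2 * z.re * γ 1 0) =
        4 - 4 * (w.im * z.im * γ 1 0 ^ 2) ∧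
      (2 * γ 0 0 - 2 * w.re * γ 1 0) * z.im = w.im * (2 * γ 1 1 + 2 * z.re * γ 1 0) := by
  obtain ⟨hre, him⟩ := (smul_eq_iff γ z w).1 h
  have hdet : (γ 0 0 : ℝ) * γ 1 1 - γ 0 1 * γ 1 0 = 1 := mod_cast det_eq_one γ
  exact ⟨by linear_combination 4 * hdet + 4 * γ 1 0 * hre, by linear_combination 2 * him⟩

lemma eq_one_or_eq_four_of_dvd (hp : 1 < p) (hodd : Odd p) {N : ℤ} (h₀ : 0 ≤ N) (h₄ : N ≤ 4)
    (hdvd : (p : ℤ) ∣ 4 - N) : N = 1 ∨ N = 4 := by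
  by_contra! hN
  have hle := Int.le_of_dvd (by omega) hdvd
  obtain rfl : p = 3 := by obtain ⟨k, rfl⟩ := hodd; omega
  omega

/-- The product of the cross terms is an integer between `0` and `4` that is `4` modulo `p`. -/
lemma cross_terms_mul_eq (hp : 1 < p) (hodd : Odd p) {γ : SL(2, ℤ)}
    (hγ : γ ∈ CongruenceSubgroup.Gamma0 p) {z w : ℍ} (h : γ • z = w) {j k : ℤ}
    (hz : 2 * z.re = j) (hw : 2 * w.re = k) :
    (2 * γ 0 0 - k * γ 1 0) * (2 * γ 1 1 + j * γ 1 0) = 1 ∨ γ 1 0 = 0 := by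
  obtain ⟨hmul, hprop⟩ := cross_terms_of_smul_eq h
  rw [hz, hw] at hmul hprop
  have hzw := mul_pos w.im_pos z.im_pos
  have hle : (2 * γ 0 0 - k * γ 1 0) * (2 * γ 1 1 + j * γ 1 0) ≤ 4 := by
    have : (2 * γ 0 0 - k * γ 1 0 : ℝ) * (2 * γ 1 1 + j * γ 1 0) ≤ 4 := by
      rw [hmul]; linarith [mul_nonneg hzw.le (sq_nonneg (γ 1 0 : ℝ))]
    exact_mod_cast this
  have hnonneg : 0 ≤ (2 * γ 0 0 - k * γ 1 0) * (2 * γ 1 1 + j * γ 1 0) := by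
    have : 0 ≤ (2 * γ 0 0 - k * γ 1 0 : ℝ) * (2 * γ 1 1 + j * γ 1 0) := by
      refine nonneg_of_mul_nonneg_left (b := z.im) ?_ z.im_pos
      rw [mul_right_comm, hprop, mul_assoc]
      exact mul_nonneg w.im_pos.le (mul_self_nonneg _)
    exact_mod_cast this
  have hdvd : (p : ℤ) ∣ 4 - (2 * γ 0 0 - k * γ 1 0) * (2 * γ 1 1 + j * γ 1 0) := by
    refine (mem_Gamma0_iff.1 hγ).trans
      ⟨-4 * γ 0 1 + 2 * k * γ 1 1 - 2 * γ 0 0 * j + k * j * γ 1 0, ?_⟩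
    linear_combination (-4) * det_eq_one γ
  refine (eq_one_or_eq_four_of_dvd hp hodd hnonneg hle hdvd).imp_right fun hN ↦ ?_
  have hN' : (2 * γ 0 0 - k * γ 1 0 : ℝ) * (2 * γ 1 1 + j * γ 1 0) = 4 := mod_cast hN
  have hc : w.im * z.im * (γ 1 0 : ℝ) ^ 2 = 0 := by linarith
  exact_mod_cast pow_eq_zero_iff two_ne_zero |>.1 ((mul_eq_zero.1 hc).resolve_left hzw.ne')

lemma exists_T_zpow_smul_eq_of_two_mul_re (hp : 1 < p) (hodd : Odd p) {z w : ℍ}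
    (h : Equiv₀ p (ofUHP z) (ofUHP w)) {j k : ℤ} (hz : 2 * z.re = j) (hw : 2 * w.re = k) :
    ∃ n : ℤ, T ^ n • z = w := by
  obtain ⟨γ, hγ, h⟩ := equiv₀_ofUHP_iff.1 h
  rcases cross_terms_mul_eq hp hodd hγ h hz hw with hN | hc
  · obtain ⟨hAB, hA⟩ : 2 * γ 0 0 - k * γ 1 0 = 2 * γ 1 1 + j * γ 1 0 ∧
        Odd (2 * γ 0 0 - k * γ 1 0) := by
      rcases Int.mul_eq_one_iff_eq_one_or_neg_one.1 hN with ⟨hA, hB⟩ | ⟨hA, hB⟩ <;>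
        rw [hA, hB] <;> decide
    have hB : Odd (2 * γ 1 1 + j * γ 1 0) := hAB ▸ hA
    rw [Int.odd_sub', iff_true_right (even_two_mul _), Int.odd_mul] at hA
    rw [Int.odd_add', iff_true_right (even_two_mul _), Int.odd_mul] at hB
    obtain ⟨n, hn⟩ := hA.1.sub_odd hB.1
    have hn' : (k : ℝ) - j = n + n := mod_cast hn
    have him : z.im = w.im := by
      have hprop := (cross_terms_of_smul_eq h).2
      have hAB' : (2 * γ 0 0 - k * γ 1 0 : ℝ) = 2 * γ 1 1 + j * γ 1 0 := mod_cast hAB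
      have hne : (2 * γ 0 0 - k * γ 1 0 : ℝ) ≠ 0 := mod_cast left_ne_zero_of_mul_eq_one hN
      rw [hz, hw, ← hAB', mul_comm w.im] at hprop
      exact mul_left_cancel₀ hne hprop
    refine ⟨n, UpperHalfPlane.ext_re_im ?_ ?_⟩
    · exact (ModularGroup.re_T_zpow_smul z n).trans (by linarith)
    · exact (ModularGroup.im_T_zpow_smul z n).trans him
  · obtain ⟨n, hn⟩ := ModularGroup.exists_eq_T_zpow_of_c_eq_zero hc
    exact ⟨n, by rw [← hn, h]⟩

lemma eq_of_equiv₀_of_re (hp : 1 < p) (hodd : Odd p) {z w : ℍ}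
    (hz : z.re = 0 ∨ z.re = 1 / 2) (hw : w.re = 0 ∨ w.re = 1 / 2)
    (h : Equiv₀ p (ofUHP z) (ofUHP w)) : z = w := by
  have hint {z : ℍ} (hz : z.re = 0 ∨ z.re = 1 / 2) :
      ∃ j : ℤ, 2 * z.re = j ∧ 0 ≤ j ∧ j ≤ 1 := by
    rcases hz with hz | hz
    · exact ⟨0, by simp [hz]⟩
    · exact ⟨1, by simp [hz]⟩
  obtain ⟨j, hj, hj₀, hj₁⟩ := hint hz
  obtain ⟨k, hk, hk₀, hk₁⟩ := hint hw
  obtain ⟨n, rfl⟩ := exists_T_zpow_smul_eq_of_two_mul_re hp hodd h hj hk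
  rw [ModularGroup.re_T_zpow_smul] at hk
  have hjk : j + 2 * n = k := by
    have : (j : ℝ) + 2 * n = k := by linarith
    exact_mod_cast this
  obtain rfl : n = 0 := by omega
  rw [zpow_zero, one_smul]

lemma dvd_sub_one_or_dvd_add_one (hp : IsPrimePow p) (hodd : Odd p) {n : ℤ}
    (h : (p : ℤ) ∣ n ^ 2 - 1) : (p : ℤ) ∣ n - 1 ∨ (p : ℤ) ∣ n + 1 := by
  obtain ⟨q, k, hq, hk, rfl⟩ := (isPrimePow_nat_iff p).1 hp
  have hfactor : n ^ 2 - 1 = (n - 1) * (n + 1) := by ring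
  rw [hfactor] at h
  push_cast at h ⊢
  have hqodd : ¬ (q : ℤ) ∣ 2 := fun hq2 ↦ by
    obtain rfl := (Nat.prime_dvd_prime_iff_eq hq Nat.prime_two).1 (mod_cast hq2)
    exact Nat.not_even_iff_odd.2 hodd (even_two.pow_of_ne_zero hk.ne')
  have hqZ := Nat.prime_iff_prime_int.1 hq
  by_cases hqn : (q : ℤ) ∣ n - 1
  · refine Or.inl ((IsCoprime.pow_left ?_).dvd_of_dvd_mul_right h)
    exact hqZ.coprime_iff_not_dvd.2 fun hqn' ↦ hqodd (by simpa using dvd_sub hqn' hqn)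
  · exact Or.inr ((hqZ.coprime_iff_not_dvd.2 hqn).pow_left.dvd_of_dvd_mul_left h)

lemma exists_isCoprime_isotropic {a b c ε : ℤ} (hdet : a ^ 2 - b * c = 1) (hε : ε ^ 2 = 1) :
    ∃ u v : ℤ, IsCoprime u v ∧ c * u = (ε - a) * v ∧
      c * u ^ 2 + 2 * a * u * v + b * v ^ 2 = 0 := by
  rcases eq_or_ne c 0 with rfl | hc
  · exact ⟨1, 0, isCoprime_one_left, by simp, by simp⟩
  obtain ⟨u, v, huv, hu, hv⟩ := Int.exists_gcd_one (m := ε - a) (n := c)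
    (Int.gcd_pos_of_ne_zero_right _ hc)
  have hcu : c * u = (ε - a) * v := by
    linear_combination u * hv - v * hu
  refine ⟨u, v, Int.isCoprime_iff_gcd_eq_one.2 huv, hcu, mul_left_cancel₀ hc ?_⟩
  linear_combination (c * u + 2 * a * v + (ε - a) * v) * hcu - v ^ 2 * hdet + v ^ 2 * hε

lemma reflectConj_mul_mul_inv_one_zero (g γ : SL(2, ℤ)) : (reflectConj g * γ * g⁻¹) 1 0 =
    γ 1 0 * g 1 1 ^ 2 - (γ 0 0 + γ 1 1) * g 1 1 * g 1 0 + γ 0 1 * g 1 0 ^ 2 := by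
  simp only [Matrix.SpecialLinearGroup.coe_mul, Matrix.mul_apply, Fin.sum_univ_two,
    Matrix.SpecialLinearGroup.coe_inv, Matrix.adjugate_fin_two, Matrix.of_apply,
    Matrix.cons_val', Matrix.cons_val_zero, Matrix.cons_val_one, Matrix.cons_val_fin_one]
  simp only [reflectConj, Matrix.of_apply, Matrix.cons_val', Matrix.cons_val_zero,
    Matrix.cons_val_one, Matrix.cons_val_fin_one]
  ring

lemma two_mul_re_eq_of_smul_eq_J_smul {γ : SL(2, ℤ)} {z : ℍ} (h : γ • z = J • z)
    (hc : γ 1 0 = 0) : 2 * z.re = ((-(γ 0 0 * γ 0 1) : ℤ) : ℝ) := by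
  obtain ⟨had, h⟩ := (smul_eq_J_smul_iff γ z).1 h
  have hdet : (γ 0 0 : ℝ) * γ 0 0 = 1 := by
    have := det_eq_one γ
    rw [← had, hc, mul_zero, sub_zero] at this
    exact_mod_cast this
  rw [hc, Int.cast_zero, zero_mul, zero_add] at h
  push_cast
  linear_combination (-2 * z.re) * hdet + (γ 0 0 : ℝ) * h

/-- The fixed circle of `z ↦ γ⁻¹ (J z)` has two rational end points; that `p` is a prime power
makes one of them a cusp equivalent to `∞`. -/
lemma exists_mem_Gamma0_two_mul_re (hp : IsPrimePow p) (hodd : Odd p) {γ : SL(2, ℤ)}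
    (hγ : γ ∈ CongruenceSubgroup.Gamma0 p) {z : ℍ} (h : γ • z = J • z) :
    ∃ g ∈ CongruenceSubgroup.Gamma0 p, ∃ n : ℤ, 2 * (g • z).re = n := by
  have had := ((smul_eq_J_smul_iff γ z).1 h).1
  have hdet : γ 0 0 ^ 2 - γ 0 1 * γ 1 0 = 1 := by
    linear_combination det_eq_one γ + γ 0 0 * had
  rw [mem_Gamma0_iff] at hγ
  obtain ⟨ε, hε, m, hm⟩ : ∃ ε : ℤ, ε ^ 2 = 1 ∧ (p : ℤ) ∣ γ 0 0 + ε := by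
    have hsq : (p : ℤ) ∣ γ 0 0 ^ 2 - 1 := by
      rw [show γ 0 0 ^ 2 - 1 = γ 0 1 * γ 1 0 by linear_combination hdet]
      exact hγ.mul_left _
    rcases dvd_sub_one_or_dvd_add_one hp hodd hsq with h | h
    · exact ⟨-1, by norm_num, h⟩
    · exact ⟨1, by norm_num, h⟩
  obtain ⟨u, v, huv, hcu, hQ⟩ := exists_isCoprime_isotropic hdet hε
  have hpv : (p : ℤ) ∣ v := by
    obtain ⟨k, hk⟩ := hodd
    have hk' : (p : ℤ) = 2 * k + 1 := mod_cast hk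
    have hcop : IsCoprime (p : ℤ) (ε - γ 0 0) :=
      ⟨1 - k * ε * m, -k * ε, by linear_combination k * ε * hm - 2 * k * hε + hk'⟩
    exact hcop.dvd_of_dvd_mul_left (hcu ▸ hγ.mul_right u)
  obtain ⟨g, hg₀, hg₁⟩ := huv.symm.neg_right.exists_SL2_row 1
  refine ⟨g, by rwa [mem_Gamma0_iff, hg₀], _,
    two_mul_re_eq_of_smul_eq_J_smul (γ := reflectConj g * γ * g⁻¹) ?_ ?_⟩
  · rw [J_smul_smul, ← h, mul_smul, mul_smul, inv_smul_smul]
  · rw [reflectConj_mul_mul_inv_one_zero, hg₀, hg₁, ← had]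
    linear_combination hQ

lemma exists_equiv₀_re_eq_zero_or_half (hp : IsPrimePow p) (hodd : Odd p) {z : ℍ}
    (h : Equiv₀ p (ofUHP z) (sigma (ofUHP z))) :
    ∃ w : ℍ, (w.re = 0 ∨ w.re = 1 / 2) ∧ Equiv₀ p (ofUHP z) (ofUHP w) := by
  obtain ⟨γ, hγ, h⟩ := equiv₀_sigma_iff.1 h
  obtain ⟨g, hg, n, hn⟩ := exists_mem_Gamma0_two_mul_re hp hodd hγ h
  obtain ⟨m, hm⟩ := Int.even_or_odd' n
  refine ⟨(T ^ (-m) * g) • z, ?_,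
    equiv₀_ofUHP_iff.2 ⟨_, mul_mem (T_zpow_mem_Gamma0 p _) hg, rfl⟩⟩
  rw [mul_smul, ModularGroup.re_T_zpow_smul]
  rcases hm with rfl | rfl <;> push_cast at hn ⊢
  · exact Or.inl (by linarith)
  · exact Or.inr (by linarith)

lemma injOn_orbitMap (hp : 1 < p) (hodd : Odd p) :
    InjOn (orbitMap p) (verticalLine 0 ∪ verticalLine (1 / 2)) := by
  have hline {s : Sphere} (hs : s ∈ verticalLine 0 ∪ verticalLine (1 / 2)) :
      ∃ z : ℍ, (z.re = 0 ∨ z.re = 1 / 2) ∧ ofUHP z = s := by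
    rcases hs with ⟨z, hz, rfl⟩ | ⟨z, hz, rfl⟩
    exacts [⟨z, Or.inl hz, rfl⟩, ⟨z, Or.inr hz, rfl⟩]
  intro s hs t ht hst
  obtain ⟨z, hz, rfl⟩ := hline hs
  obtain ⟨w, hw, rfl⟩ := hline ht
  rw [eq_of_equiv₀_of_re hp hodd hz hw (Quotient.exact hst)]

lemma image_orbitMap_fixSet (hp : IsPrimePow p) (hodd : Odd p) :
    orbitMap p '' fixSet (CongruenceSubgroup.Gamma0 p) (range ofUHP) =
      orbitMap p '' verticalLine 0 ∪ orbitMap p '' verticalLine (1 / 2) := by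
  rw [← image_union]
  apply Subset.antisymm
  · rintro _ ⟨s, hs, rfl⟩
    obtain ⟨⟨z, rfl⟩, hz⟩ := mem_fixSet_iff.1 hs
    obtain ⟨w, hw, hzw⟩ := exists_equiv₀_re_eq_zero_or_half hp hodd hz
    exact ⟨ofUHP w, hw.imp (mem_image_of_mem _) (mem_image_of_mem _), Quotient.sound hzw.symm⟩
  · rintro _ ⟨_, ⟨z, hz, rfl⟩ | ⟨z, hz, rfl⟩, rfl⟩ <;> rw [mem_ofPred_eq] at hz
    · exact ⟨_, mem_fixSet_iff.2 ⟨⟨z, rfl⟩, equiv₀_sigma_of_two_mul_re (n := 0) (by simp [hz])⟩,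
        rfl⟩
    · exact ⟨_, mem_fixSet_iff.2 ⟨⟨z, rfl⟩, equiv₀_sigma_of_two_mul_re (n := 1) (by simp [hz])⟩,
        rfl⟩

lemma moeb_image_verticalLine_ne (hp : 1 < p) (hodd : Odd p) {γ : SL(2, ℤ)}
    (hγ : γ ∈ CongruenceSubgroup.Gamma0 p) :
    moeb γ '' verticalLine 0 ≠ verticalLine (1 / 2) := by
  intro h
  have hI := UpperHalfPlane.I_re
  obtain ⟨w, hw : w.re = 1 / 2, hIw⟩ : moeb γ (ofUHP UpperHalfPlane.I) ∈ verticalLine (1 / 2) :=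
    h ▸ mem_image_of_mem _ (mem_image_of_mem _ hI)
  obtain rfl := eq_of_equiv₀_of_re hp hodd (Or.inl hI) (Or.inr hw) ⟨γ, hγ, hIw.symm⟩
  norm_num [hI] at hw

end

/-! ### The domain and its images under `S` -/

section

/-- The translates of the standard domain in the strip `|Re w| ≤ r`. Under `S` they become the
triangles `α_l F`, so that in the coordinate `w = S z` all of these are treated at once. -/
def fdStrip (r : ℝ) : Set ℍ := {w | |w.re| ≤ r ∧ ∀ n : ℤ, 1 ≤ (w.re + n) ^ 2 + w.im ^ 2}

lemma mem_fd_iff {z : ℍ} : z ∈ ModularGroup.fd ↔ 1 ≤ z.re ^ 2 + z.im ^ 2 ∧ |z.re| ≤ 1 / 2 := by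
  rw [ModularGroup.fd, mem_ofPred_eq, Complex.normSq_apply, ← sq, ← sq, UpperHalfPlane.coe_re,
    UpperHalfPlane.coe_im]

lemma fd_subset_fdStrip : ModularGroup.fd ⊆ fdStrip (1 / 2) := by
  intro z hz
  obtain ⟨hnorm, hre⟩ := mem_fd_iff.1 hz
  refine ⟨hre, fun n ↦ hnorm.trans ?_⟩
  have hn : (|n| : ℝ) ≤ n ^ 2 := by
    rw [← sq_abs]
    exact mod_cast Int.le_self_sq |n|
  have hmul : |z.re * n| ≤ |(n : ℝ)| / 2 := by
    rw [abs_mul]; linarith [mul_le_mul_of_nonneg_right hre (abs_nonneg (n : ℝ))]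
  linarith [neg_abs_le (z.re * n)]

variable {r : ℝ} {w : ℍ}

lemma T_zpow_smul_mem_fdStrip (hw : w ∈ fdStrip r) (m : ℤ) : T ^ m • w ∈ fdStrip (r + |m|) := by
  refine ⟨?_, fun n ↦ ?_⟩ <;> rw [ModularGroup.re_T_zpow_smul]
  · push_cast
    exact (abs_add_le _ _).trans (add_le_add_left hw.1 _)
  · rw [ModularGroup.im_T_zpow_smul]
    simpa [add_assoc] using hw.2 (m + n)

lemma three_le_four_mul_im_sq (hw : w ∈ fdStrip r) : 3 ≤ 4 * w.im ^ 2 := by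
  have habs := abs_sub_round w.re
  have hround := sq_le_sq' (neg_le_of_abs_le habs) (le_of_abs_le habs)
  have := hw.2 (-round w.re)
  push_cast [← sub_eq_add_neg] at this
  linarith

lemma abs_re_add_le_half (hw : w ∈ fdStrip r) {n : ℤ} (h : (w.re + n) ^ 2 + w.im ^ 2 = 1) :
    |w.re + n| ≤ 1 / 2 := by
  have h₁ := hw.2 (n + 1)
  have h₂ := hw.2 (n - 1)
  push_cast at h₁ h₂
  exact abs_le.2 ⟨by linarith, by linarith⟩

lemma one_zero_eq_zero_or_of_mem_fdStrip (hw : w ∈ fdStrip r) {γ : SL(2, ℤ)}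
    (h : γ • w = J • w) : γ 1 0 = 0 ∨
      (γ 1 0 ^ 2 = 1 ∧ (w.re + (γ 0 0 * γ 1 0 : ℤ)) ^ 2 + w.im ^ 2 = 1) := by
  obtain ⟨had, hcirc⟩ := (smul_eq_J_smul_iff γ w).1 h
  have hdet : (γ 0 0 : ℝ) ^ 2 - γ 0 1 * γ 1 0 = 1 := by
    have := det_eq_one γ
    rw [← had, ← sq] at this
    exact_mod_cast this
  have hnorm : (γ 1 0 * w.re + γ 0 0) ^ 2 + γ 1 0 ^ 2 * w.im ^ 2 = 1 := by
    linear_combination hdet + γ 1 0 * hcirc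
  have hc : γ 1 0 ^ 2 ≤ 1 := by
    have : (γ 1 0 : ℝ) ^ 2 < 2 := by
      nlinarith [three_le_four_mul_im_sq hw, sq_nonneg (γ 1 0 * w.re + γ 0 0 : ℝ),
        sq_nonneg (γ 1 0 : ℝ)]
    exact Int.lt_add_one_iff.1 (mod_cast this)
  refine or_iff_not_imp_left.2 fun hc₀ ↦ ?_
  have hc₁ : γ 1 0 ^ 2 = 1 := hc.antisymm (Int.add_one_le_iff.2 (sq_pos_of_ne_zero hc₀))
  have hc₂ : (γ 1 0 : ℝ) ^ 2 = 1 := mod_cast hc₁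
  refine ⟨hc₁, ?_⟩
  push_cast
  linear_combination hnorm + (γ 0 0 ^ 2 - w.re ^ 2 - w.im ^ 2 : ℝ) * hc₂

variable {p : ℕ}

lemma re_eq_zero_or_half_of_mem_fd (hp : 1 < p) {z : ℍ} (hz : z ∈ ModularGroup.fd) (hre : 0 ≤ z.re)
    (h : Equiv₀ p (ofUHP z) (sigma (ofUHP z))) : z.re = 0 ∨ z.re = 1 / 2 := by
  obtain ⟨γ, hγ, h⟩ := equiv₀_sigma_iff.1 h
  have hc : γ 1 0 = 0 := by
    refine (one_zero_eq_zero_or_of_mem_fdStrip (fd_subset_fdStrip hz) h).resolve_right ?_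
    rintro ⟨hc, -⟩
    have hdvd : (p : ℤ) ∣ 1 := hc ▸ (mem_Gamma0_iff.1 hγ).trans (dvd_pow_self _ two_ne_zero)
    have := Int.le_of_dvd one_pos hdvd
    omega
  have hn := two_mul_re_eq_of_smul_eq_J_smul h hc
  generalize -(γ 0 0 * γ 0 1) = n at hn
  have hle := le_of_abs_le (mem_fd_iff.1 hz).2
  have hn₀ : 0 ≤ n := by
    have : (0 : ℝ) ≤ n := by linarith
    exact_mod_cast this
  have hn₁ : n ≤ 1 := by
    have : (n : ℝ) ≤ 1 := by linarith
    exact_mod_cast this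
  interval_cases n
  · exact Or.inl (by simpa using hn)
  · exact Or.inr (by push_cast at hn; linarith)

lemma abs_eq_one_or_two_of_dvd (hp : 3 ≤ p) {n : ℤ} (hn : 2 * |n| ≤ p + 1)
    (h : (p : ℤ) ∣ n - 1 ∨ (p : ℤ) ∣ n + 1) : |n| = 1 ∨ (p = 3 ∧ |n| = 2) := by
  wlog hdvd : (p : ℤ) ∣ n - 1 generalizing n
  · have hneg : (p : ℤ) ∣ -n - 1 := by
      rw [← neg_add', dvd_neg]
      exact h.resolve_left hdvd
    simpa using this (n := -n) (by simpa using hn) (Or.inl hneg) hneg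
  obtain ⟨m, hm⟩ := hdvd
  have hp' : (3 : ℤ) ≤ p := mod_cast hp
  have hle := le_abs_self n
  have hge := neg_abs_le n
  have hm₀ : m < 1 := by nlinarith
  have hm₁ : -2 < m := by nlinarith
  obtain rfl | rfl : m = 0 ∨ m = -1 := by omega
  · obtain rfl : n = 1 := by omega
    exact Or.inl abs_one
  · obtain ⟨rfl, rfl⟩ : p = 3 ∧ n = -2 := by omega
    exact Or.inr ⟨rfl, rfl⟩

end

section
variable {p : ℕ}

lemma S_mul_mul_S (γ : SL(2, ℤ)) :
    (S * γ * S : SL(2, ℤ)).1 = !![-γ 1 1, γ 1 0; γ 0 1, -γ 0 0] := by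
  rw [Matrix.SpecialLinearGroup.coe_mul, Matrix.SpecialLinearGroup.coe_mul, ModularGroup.coe_S,
    Matrix.eta_fin_two γ.1]
  simp

lemma S_mul_mul_S_smul_eq {γ : SL(2, ℤ)} {w : ℍ} (h : γ • S • w = J • S • w) :
    (S * γ * S) • w = J • w := by
  have hS : reflectConj S = S⁻¹ := by
    ext i j
    rw [Matrix.SpecialLinearGroup.coe_inv, ModularGroup.coe_S]
    fin_cases i <;> fin_cases j <;> simp [reflectConj, ModularGroup.coe_S]
  rw [mul_smul, mul_smul, h, J_smul_smul, hS, smul_inv_smul]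

lemma re_eq_zero_or_of_dvd {x : ℝ} {n : ℤ} (hx : |x| ≤ p / 2) (hn : 2 * x = n)
    (hdvd : (p : ℤ) ∣ n) : x = 0 ∨ |x| = p / 2 := by
  have habs : |x| * 2 = |(n : ℝ)| := by rw [← hn, abs_mul, abs_two, mul_comm]
  have hle : |n| ≤ p := by
    have : |(n : ℝ)| ≤ p := by linarith
    exact_mod_cast this
  rcases hle.lt_or_eq with hlt | heq
  · left
    rw [Int.eq_zero_of_abs_lt_dvd hdvd hlt] at hn
    simpa using hn
  · right
    have : |(n : ℝ)| = p := mod_cast heq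
    linarith

lemma re_eq_or_of_norm_eq_one (hp : IsPrimePow p) (hodd : Odd p) {w : ℍ}
    (hw : w ∈ fdStrip (p / 2)) (hre : w.re ≤ 0) {n : ℤ} (hdvd : (p : ℤ) ∣ n ^ 2 - 1)
    (h : (w.re + n) ^ 2 + w.im ^ 2 = 1) :
    w.re = -(p / 2) ∨ (w.re + 1) ^ 2 + w.im ^ 2 = 1 := by
  obtain ⟨hn₁, hn₂⟩ := abs_le.1 (abs_re_add_le_half hw h)
  obtain ⟨hr₁, hr₂⟩ := abs_le.1 hw.1
  have hn_nonneg : 0 ≤ n := by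
    have : (-1 : ℝ) < n := by linarith
    exact Int.lt_iff_add_one_le.1 (by exact_mod_cast this)
  have hn_le : 2 * |n| ≤ p + 1 := by
    have : (2 * n : ℝ) ≤ p + 1 := by linarith
    rw [abs_of_nonneg hn_nonneg]
    exact_mod_cast this
  have hp₃ : 3 ≤ p := by
    obtain ⟨k, rfl⟩ := hodd
    have := hp.one_lt
    omega
  have hcases := abs_eq_one_or_two_of_dvd hp₃ hn_le
    (dvd_sub_one_or_dvd_add_one hp hodd hdvd)
  rw [abs_of_nonneg hn_nonneg] at hcases
  rcases hcases with rfl | ⟨rfl, rfl⟩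
  · exact Or.inr (by simpa using h)
  · push_cast at *
    exact Or.inl (by linarith)

lemma re_eq_or_of_fixed_S_smul (hp : IsPrimePow p) (hodd : Odd p) {w : ℍ}
    (hw : w ∈ fdStrip (p / 2)) (hre : w.re ≤ 0)
    (h : Equiv₀ p (ofUHP (S • w)) (sigma (ofUHP (S • w)))) :
    w.re = 0 ∨ w.re = -(p / 2) ∨ (w.re + 1) ^ 2 + w.im ^ 2 = 1 := by
  obtain ⟨γ, hγ, h⟩ := equiv₀_sigma_iff.1 h
  have had := ((smul_eq_J_smul_iff _ _).1 h).1
  have hfix := S_mul_mul_S_smul_eq h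
  rw [mem_Gamma0_iff] at hγ
  rcases one_zero_eq_zero_or_of_mem_fdStrip hw hfix with hb | ⟨hb, hcirc⟩
  · have hn := two_mul_re_eq_of_smul_eq_J_smul hfix hb
    refine (re_eq_zero_or_of_dvd hw.1 hn ?_).imp_right fun h ↦ Or.inl ?_
    · rw [S_mul_mul_S]
      simpa using hγ.mul_left _
    · rw [← h, abs_of_nonpos hre, neg_neg]
  · refine Or.inr (re_eq_or_of_norm_eq_one hp hodd hw hre ?_ hcirc)
    rw [S_mul_mul_S] at hb ⊢
    simp only [Matrix.of_apply, Matrix.cons_val', Matrix.cons_val_zero, Matrix.cons_val_one,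
      Matrix.cons_val_fin_one] at hb ⊢
    have hsq : (-γ 1 1 * γ 0 1) ^ 2 - 1 = γ 1 0 * γ 0 1 := by
      linear_combination γ 1 1 ^ 2 * hb - γ 1 1 * had + det_eq_one γ
    exact hsq ▸ hγ.mul_right _

/-! ### The fixed points in the domain -/

lemma alpha_eq (l : ℤ) : alpha l = S * T ^ (-l) := by
  ext i j
  rw [Matrix.SpecialLinearGroup.coe_mul, ModularGroup.coe_S, ModularGroup.coe_T_zpow]
  fin_cases i <;> fin_cases j <;> simp [alpha]

lemma alpha_smul (l : ℤ) (z : ℍ) : alpha l • z = S • T ^ (-l) • z := by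
  rw [alpha_eq, mul_smul]

lemma ofUHP_mem_standardF {z : ℍ} : ofUHP z ∈ standardF ↔ z ∈ ModularGroup.fd := by
  simp [standardF, ofUHP_ne_infty, ofUHP_injective.eq_iff]

lemma standardF_subset_Xp (p : ℕ) : standardF ⊆ Xp p := subset_union_left

lemma moeb_alpha_mem_Xp {l : ℤ} (hl : 2 * |l| < p) {s : Sphere} (hs : s ∈ standardF) :
    moeb (alpha l) s ∈ Xp p :=
  Or.inr (mem_biUnion (by rw [mem_ofPred_eq]; omega) (mem_image_of_mem _ hs))

lemma S_smul_mem_Xp {l : ℤ} (hl : 2 * |l| < p) {w : ℍ} (hw : T ^ l • w ∈ ModularGroup.fd) :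
    ofUHP (S • w) ∈ Xp p := by
  have h := moeb_alpha_mem_Xp hl (ofUHP_mem_standardF.2 hw)
  rwa [moeb_ofUHP, alpha_smul, zpow_neg, inv_smul_smul] at h

lemma moeb_alpha_infty (l : ℤ) : moeb (alpha l) ∞ = ((0 : ℂ) : OnePoint ℂ) := by
  rw [moeb_infty]
  simp [alpha]

lemma mem_Xp_cases {s : Sphere} (hs : s ∈ Xp p) :
    s = ∞ ∨ s = ((0 : ℂ) : OnePoint ℂ) ∨ (∃ z ∈ ModularGroup.fd, s = ofUHP z) ∨
      ∃ w ∈ fdStrip (p / 2), s = ofUHP (S • w) := by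
  rcases hs with (rfl | ⟨z, hz, rfl⟩) | hs
  · exact Or.inl rfl
  · exact Or.inr (Or.inr (Or.inl ⟨z, hz, rfl⟩))
  obtain ⟨l, hl, t, rfl | ⟨z, hz, rfl⟩, rfl⟩ := mem_iUnion₂.1 hs
  · exact Or.inr (Or.inl (moeb_alpha_infty l))
  · refine Or.inr (Or.inr (Or.inr ⟨T ^ (-l) • z, ?_, by rw [moeb_ofUHP, alpha_smul]⟩))
    obtain ⟨hre, hn⟩ := T_zpow_smul_mem_fdStrip (fd_subset_fdStrip hz) (-l)
    refine ⟨hre.trans ?_, hn⟩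
    have hl' : (1 + 2 * |l| : ℤ) ≤ p := by rw [mem_ofPred_eq] at hl; omega
    have : (1 + 2 * |(l : ℝ)|) ≤ p := mod_cast hl'
    rw [abs_neg, Int.cast_abs]
    linarith

lemma sigma_mem_standardF {s : Sphere} (hs : s ∈ standardF) : sigma s ∈ standardF := by
  rcases hs with rfl | ⟨z, hz, rfl⟩
  · exact Or.inl rfl
  · rw [mem_fd_iff] at hz
    rw [sigma_ofUHP, ofUHP_mem_standardF, mem_fd_iff, re_J_smul, im_J_smul]
    simpa using hz

lemma moeb_neg (γ : SL(2, ℤ)) (s : Sphere) : moeb (-γ) s = moeb γ s := by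
  induction s using OnePoint.rec with
  | infty => simp [moeb_infty, neg_div_neg_eq]
  | coe z =>
    simp only [moeb_coe, Matrix.SpecialLinearGroup.coe_neg, Matrix.neg_apply, Int.cast_neg,
      neg_mul, ← neg_add, neg_eq_zero, neg_div_neg_eq]

lemma sigma_moeb_alpha (l : ℤ) (s : Sphere) :
    sigma (moeb (alpha l) s) = moeb (alpha (-l)) (sigma s) := by
  have : reflectConj (alpha l) = -alpha (-l) := by
    ext i j
    rw [Matrix.SpecialLinearGroup.coe_neg]
    fin_cases i <;> fin_cases j <;> simp [reflectConj, alpha]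
  rw [sigma_moeb, this, moeb_neg]

lemma sigma_mem_Xp {s : Sphere} (hs : s ∈ Xp p) : sigma s ∈ Xp p := by
  rcases hs with hs | hs
  · exact standardF_subset_Xp p (sigma_mem_standardF hs)
  · obtain ⟨l, hl, t, ht, rfl⟩ := mem_iUnion₂.1 hs
    rw [sigma_moeb_alpha]
    refine Or.inr (mem_biUnion (x := -l) ?_ (mem_image_of_mem _ (sigma_mem_standardF ht)))
    rwa [mem_ofPred_eq, abs_neg]

end

section
variable {p : ℕ} {L : ℤ} {r α : ℝ} {s : Sphere}

/-- The vertical ray from `r + iα` to `∞`, both end points included. -/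
def verticalRay (r α : ℝ) : Set Sphere :=
  insert ∞ ((fun y : ℝ ↦ ((⟨r, y⟩ : ℂ) : OnePoint ℂ)) '' Ici α)

/-- The arc of the boundary of `Xp p` from the cusp `0` to the vertex `c_L`, where `2 L + 1 = p`. -/
def lowerArc (p : ℕ) : Set Sphere := moeb S '' verticalRay (-(p / 2)) (√3 / 2)

lemma infty_mem_verticalRay (r α : ℝ) : ∞ ∈ verticalRay r α := mem_insert _ _

lemma mem_verticalRay_iff (hα : 0 < α) :
    s ∈ verticalRay r α ↔ s = ∞ ∨ ∃ w : ℍ, w.re = r ∧ α ≤ w.im ∧ s = ofUHP w := by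
  refine or_congr_right ⟨?_, ?_⟩
  · rintro ⟨y, hy, rfl⟩
    exact ⟨⟨⟨r, y⟩, hα.trans_le hy⟩, rfl, hy, rfl⟩
  · rintro ⟨w, rfl, hw, rfl⟩
    exact ⟨w.im, hw, rfl⟩

lemma verticalRay_zero_zero :
    verticalRay 0 0 = {((0 : ℂ) : OnePoint ℂ), ∞} ∪ verticalLine 0 := by
  ext s
  constructor
  · rintro (rfl | ⟨y, hy, rfl⟩)
    · exact Or.inl (Or.inr rfl)
    · rcases (mem_Ici.1 hy).eq_or_lt with rfl | hy
      · exact Or.inl (Or.inl rfl)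
      · exact Or.inr ⟨⟨⟨0, y⟩, hy⟩, rfl, rfl⟩
  · rintro ((rfl | rfl) | ⟨z, hz, rfl⟩)
    · exact Or.inr ⟨0, self_mem_Ici, rfl⟩
    · exact infty_mem_verticalRay _ _
    · exact Or.inr ⟨z.im, z.im_pos.le, congrArg _ (Complex.ext hz.symm rfl)⟩

lemma verticalRay_subset (hα : 0 < α) : verticalRay r α ⊆ {∞} ∪ verticalLine r := by
  intro s hs
  obtain rfl | ⟨w, hw, -, rfl⟩ := (mem_verticalRay_iff hα).1 hs
  exacts [Or.inl rfl, Or.inr ⟨w, hw, rfl⟩]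

lemma moeb_S_infty : moeb S ∞ = ((0 : ℂ) : OnePoint ℂ) := by
  rw [moeb_infty]
  simp [ModularGroup.coe_S]

lemma mem_lowerArc_iff : s ∈ lowerArc p ↔ s = ((0 : ℂ) : OnePoint ℂ) ∨
    ∃ w : ℍ, w.re = -(p / 2) ∧ √3 / 2 ≤ w.im ∧ s = ofUHP (S • w) := by
  rw [lowerArc, mem_image]
  simp only [mem_verticalRay_iff (r := -(p / 2 : ℝ)) (α := √3 / 2) (by positivity)]
  constructor
  · rintro ⟨_, rfl | ⟨w, hre, him, rfl⟩, rfl⟩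
    · exact Or.inl moeb_S_infty
    · exact Or.inr ⟨w, hre, him, moeb_ofUHP S w⟩
  · rintro (rfl | ⟨w, hre, him, rfl⟩)
    · exact ⟨∞, Or.inl rfl, moeb_S_infty⟩
    · exact ⟨ofUHP w, Or.inr ⟨w, hre, him, rfl⟩, moeb_ofUHP S w⟩

lemma odd_of_eq (hL : 2 * L + 1 = (p : ℤ)) : Odd p :=
  (Int.odd_coe_nat p).1 ⟨L, hL.symm⟩

/-- The element of `Γ₀(p)` that maps the arc `lowerArc p` onto the segment of `Re z = 1 / 2` from
the cusp `1 / 2` to the vertex `c_1`. -/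
def gluingMat (hL : 2 * L + 1 = (p : ℤ)) : SL(2, ℤ) :=
  ⟨!![L, -1; p, -2], by rw [Matrix.det_fin_two_of]; linarith⟩

lemma gluingMat_mem_Gamma0 (hL : 2 * L + 1 = (p : ℤ)) :
    gluingMat hL ∈ CongruenceSubgroup.Gamma0 p :=
  mem_Gamma0_iff.2 dvd_rfl

lemma gluingMat_smul_S_smul (hL : 2 * L + 1 = (p : ℤ)) {w : ℍ} (hw : w.re = -(p / 2)) :
    (gluingMat hL • S • w).re = 1 / 2 ∧ (gluingMat hL • S • w).im = 1 / (4 * w.im) := by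
  obtain ⟨z, hre, him'⟩ : ∃ z : ℍ, z.re = 1 / 2 ∧ z.im = 1 / (4 * w.im) :=
    ⟨⟨⟨1 / 2, 1 / (4 * w.im)⟩, by positivity⟩, rfl, rfl⟩
  have hmat : (gluingMat hL * S).1 = !![-1, -L; -2, -p] := by
    rw [Matrix.SpecialLinearGroup.coe_mul, ModularGroup.coe_S]
    simp [gluingMat]
  have hLp : 2 * (L : ℝ) + 1 = p := mod_cast hL
  suffices h : gluingMat hL • S • w = z from h ▸ ⟨hre, him'⟩
  rw [← mul_smul, smul_eq_iff, hmat, hre, him', hw]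
  simp only [Matrix.of_apply, Matrix.cons_val', Matrix.cons_val_zero, Matrix.cons_val_one,
    Matrix.cons_val_fin_one]
  push_cast
  constructor <;> field_simp <;> linarith

lemma exists_equiv₀_S_smul (hL : 2 * L + 1 = (p : ℤ)) {w : ℍ} (hw : w.re = -(p / 2)) :
    ∃ z : ℍ, z.re = 1 / 2 ∧ z.im = 1 / (4 * w.im) ∧ Equiv₀ p (ofUHP (S • w)) (ofUHP z) :=
  ⟨_, (gluingMat_smul_S_smul hL hw).1, (gluingMat_smul_S_smul hL hw).2,
    equiv₀_ofUHP_iff.2 ⟨_, gluingMat_mem_Gamma0 hL, rfl⟩⟩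

lemma equiv₀_zero_half (hL : 2 * L + 1 = (p : ℤ)) :
    Equiv₀ p ((0 : ℂ) : OnePoint ℂ) ((1 / 2 : ℂ) : OnePoint ℂ) := by
  refine ⟨gluingMat hL, gluingMat_mem_Gamma0 hL, ?_⟩
  rw [moeb_coe]
  norm_num [gluingMat]

/-! ### The vertices -/

lemma vertex_eq (hL : 2 * L + 1 = (p : ℤ)) :
    vertex L = moeb S ((⟨-(p / 2), √3 / 2⟩ : ℂ) : OnePoint ℂ) := by
  have hLp : 2 * (L : ℝ) + 1 = p := mod_cast hL
  have hT : moeb (T ^ (-L)) (sigma rho) = ((⟨-(p / 2), √3 / 2⟩ : ℂ) : OnePoint ℂ) := by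
    rw [rho, sigma_coe, moeb_coe, ModularGroup.coe_T_zpow, ← hLp]
    have hre : -2⁻¹ + -(L : ℝ) = -((2 * L + 1) / 2) := by ring
    simpa [Complex.ext_iff] using hre
  rw [vertex, alpha_eq, moeb_mul, hT]

lemma exists_vertex_eq (hL : 2 * L + 1 = (p : ℤ)) :
    ∃ w : ℍ, w.re = -(p / 2) ∧ w.im = √3 / 2 ∧ vertex L = ofUHP (S • w) :=
  ⟨⟨⟨-(p / 2), √3 / 2⟩, by simp⟩, rfl, rfl, by rw [vertex_eq hL, ← moeb_ofUHP]; rfl⟩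

lemma vertex_one : vertex 1 = ((⟨1 / 2, √3 / 6⟩ : ℂ) : OnePoint ℂ) := by
  obtain ⟨w, hre, him, hw⟩ := exists_vertex_eq (p := 3) (L := 1) (by norm_num)
  push_cast at hre
  rw [hw, ofUHP]
  refine congrArg _ (Complex.ext ?_ ?_)
  · rw [UpperHalfPlane.coe_re, re_S_smul, hre, him, div_pow, Real.sq_sqrt zero_le_three]
    norm_num
  · rw [UpperHalfPlane.coe_im, im_S_smul, hre, him, div_pow, Real.sq_sqrt zero_le_three]
    ring

lemma exists_vertex_one : ∃ z : ℍ, z.re = 1 / 2 ∧ z.im = √3 / 6 ∧ vertex 1 = ofUHP z :=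
  ⟨⟨⟨1 / 2, √3 / 6⟩, by simp⟩, rfl, rfl, vertex_one⟩

lemma equiv₀_vertex (hL : 2 * L + 1 = (p : ℤ)) : Equiv₀ p (vertex L) (vertex 1) := by
  obtain ⟨w, hre, him, hv⟩ := exists_vertex_eq hL
  obtain ⟨z, hz, hz', hv₁⟩ := exists_vertex_one
  obtain ⟨z', hre', him', h⟩ := exists_equiv₀_S_smul hL hre
  have hzz : z = z' := by
    refine UpperHalfPlane.ext (Complex.ext (hz.trans hre'.symm) (hz'.trans (him'.trans ?_).symm))
    rw [him]
    field_simp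
    norm_num
  rwa [hv, hv₁, hzz]

end

/-! ### The curve `δ` -/

section
variable {p : ℕ} {L : ℤ} {s : Sphere}

lemma ofUHP_mem_delta_iff {z : ℍ} : ofUHP z ∈ delta p ↔
    ofUHP z ∈ Xp p ∧ 0 ≤ z.re ∧ Equiv₀ p (ofUHP z) (sigma (ofUHP z)) := by
  rw [delta, mem_fixSet_iff, XpPlus, mem_ofPred_eq, and_assoc, and_congr_right_iff]
  refine fun _ ↦ and_congr_left fun _ ↦ ⟨fun h ↦ h _ rfl, ?_⟩
  rintro h w hw
  rwa [← OnePoint.coe_injective hw]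

lemma infty_mem_delta (p : ℕ) : ∞ ∈ delta p :=
  mem_fixSet_iff.2 ⟨⟨Or.inl (Or.inl rfl), fun _ h ↦ absurd h (OnePoint.infty_ne_coe _)⟩,
    Equiv₀.refl _⟩

lemma zero_mem_delta (hp : 0 < p) : ((0 : ℂ) : OnePoint ℂ) ∈ delta p := by
  refine mem_fixSet_iff.2 ⟨⟨?_, fun w hw ↦ ?_⟩, ?_⟩
  · rw [← moeb_alpha_infty 0]
    exact moeb_alpha_mem_Xp (by simpa using hp) (Or.inl rfl)
  · rw [← OnePoint.coe_injective hw, Complex.zero_re]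
  · rw [sigma_zero]
    exact Equiv₀.refl _

lemma verticalRay_zero_subset_delta (hp : 0 < p) : verticalRay 0 0 ⊆ delta p := by
  rw [verticalRay_zero_zero]
  rintro _ ((rfl | rfl) | ⟨z, hz, rfl⟩)
  · exact zero_mem_delta hp
  · exact infty_mem_delta p
  rw [mem_ofPred_eq] at hz
  refine ofUHP_mem_delta_iff.2 ⟨?_, hz.ge, equiv₀_sigma_of_two_mul_re (n := 0) (by simp [hz])⟩
  rcases le_total 1 (z.im ^ 2) with him | him
  · exact standardF_subset_Xp p (ofUHP_mem_standardF.2 (mem_fd_iff.2 (by simp [hz, him])))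
  · rw [← S_smul_S_smul z]
    refine S_smul_mem_Xp (l := 0) (by simpa using hp) ?_
    rw [zpow_zero, one_smul, mem_fd_iff, re_S_smul, im_S_smul, hz]
    simp only [neg_zero, zero_div, abs_zero, ne_eq, OfNat.ofNat_ne_zero, not_false_eq_true,
      zero_pow, zero_add]
    refine ⟨?_, by norm_num⟩
    rw [div_pow, one_le_div (by positivity)]
    nlinarith

lemma verticalRay_half_subset_delta (hp : 3 ≤ p) : verticalRay (1 / 2) (√3 / 6) ⊆ delta p := by
  intro s hs
  obtain rfl | ⟨z, hre, him, rfl⟩ := (mem_verticalRay_iff (by positivity)).1 hs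
  · exact infty_mem_delta p
  refine ofUHP_mem_delta_iff.2
    ⟨?_, by rw [hre]; norm_num, equiv₀_sigma_of_two_mul_re (n := 1) (by simp [hre])⟩
  rcases le_total 1 (z.re ^ 2 + z.im ^ 2) with h | h
  · refine standardF_subset_Xp p (ofUHP_mem_standardF.2 (mem_fd_iff.2 ⟨h, ?_⟩))
    rw [hre, abs_of_pos one_half_pos]
  · rw [← S_smul_S_smul z]
    refine S_smul_mem_Xp (l := 1) (by rw [abs_one]; omega) ?_
    have him₂ : 1 ≤ 12 * z.im ^ 2 := by
      have := pow_le_pow_left₀ (by positivity) him 2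
      rw [div_pow, Real.sq_sqrt zero_le_three] at this
      linarith
    rw [mem_fd_iff, ModularGroup.re_T_zpow_smul, ModularGroup.im_T_zpow_smul, re_S_smul,
      im_S_smul, hre]
    obtain ⟨D, hD⟩ : ∃ D, D = (1 / 2) ^ 2 + z.im ^ 2 := ⟨_, rfl⟩
    rw [hre, ← hD] at h
    have hpos : 0 < D := by linarith
    have hinv₁ : 1 ≤ 1 / D := one_le_one_div hpos h
    have hinv₂ : 1 / D ≤ 3 := (div_le_iff₀ hpos).2 (by linarith)
    rw [← hD, Int.cast_one, neg_div, div_div, mul_comm, ← div_div]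
    refine ⟨le_of_eq ?_, abs_le.2 ⟨by linarith, by linarith⟩⟩
    field_simp
    linarith

lemma lowerArc_subset_delta (hL : 2 * L + 1 = (p : ℤ)) : lowerArc p ⊆ delta p := by
  intro s hs
  obtain rfl | ⟨w, hre, him, rfl⟩ := mem_lowerArc_iff.1 hs
  · exact zero_mem_delta (odd_of_eq hL).pos
  have hLp : 2 * (L : ℝ) + 1 = p := mod_cast hL
  refine ofUHP_mem_delta_iff.2 ⟨S_smul_mem_Xp (l := L) ?_ (mem_fd_iff.2 ?_), ?_, ?_⟩
  · rw [abs_of_nonneg (by omega)]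
    omega
  · have hre' : w.re + L = -(1 / 2) := by linarith
    have him₂ := pow_le_pow_left₀ (by positivity) him 2
    rw [div_pow, Real.sq_sqrt zero_le_three] at him₂
    rw [ModularGroup.re_T_zpow_smul, ModularGroup.im_T_zpow_smul, hre', abs_neg,
      abs_of_pos one_half_pos]
    exact ⟨by linarith, le_rfl⟩
  · rw [re_S_smul, hre, neg_neg]
    positivity
  · obtain ⟨z, hz, -, h⟩ := exists_equiv₀_S_smul hL hre
    exact h.fixed (equiv₀_sigma_of_two_mul_re (n := 1) (by simp [hz]))

lemma S_smul_of_norm_add_one_eq_one {w : ℍ} (h : (w.re + 1) ^ 2 + w.im ^ 2 = 1) :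
    (S • w).re = 1 / 2 ∧ 2 * -w.re * (1 / 4 + (S • w).im ^ 2) = 1 := by
  have hD : w.re ^ 2 + w.im ^ 2 = 2 * -w.re := by linarith
  have hne : 2 * -w.re ≠ 0 := hD ▸ (re_sq_add_im_sq_pos w).ne'
  rw [re_S_smul, im_S_smul, hD]
  constructor <;> grind

lemma delta_subset_union (hp : IsPrimePow p) (hodd : Odd p) :
    delta p ⊆ verticalRay 0 0 ∪ lowerArc p ∪ verticalRay (1 / 2) (√3 / 6) := by
  intro s hs
  have hsqrt {y : ℝ} (hy : 0 < y) {c : ℝ} (hc : 0 < c) (h : 3 ≤ c ^ 2 * y ^ 2) : √3 / c ≤ y := by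
    rw [div_le_iff₀ hc, Real.sqrt_le_left (by positivity)]
    linarith
  rw [verticalRay_zero_zero]
  rcases mem_Xp_cases hs.1.1 with rfl | rfl | ⟨z, hz, rfl⟩ | ⟨w, hw, rfl⟩
  · exact Or.inl (Or.inl (Or.inl (Or.inr rfl)))
  · exact Or.inl (Or.inl (Or.inl (Or.inl rfl)))
  · obtain ⟨-, hre, h⟩ := ofUHP_mem_delta_iff.1 hs
    refine (re_eq_zero_or_half_of_mem_fd hp.one_lt hz hre h).imp
      (fun hre ↦ Or.inl (Or.inr ⟨z, hre, rfl⟩))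
      fun hre ↦ (mem_verticalRay_iff (by positivity)).2 (Or.inr ⟨z, hre, hsqrt z.im_pos ?_ ?_, rfl⟩)
    · norm_num
    · linarith [three_le_four_mul_im_sq (fd_subset_fdStrip hz)]
  · obtain ⟨-, hre, h⟩ := ofUHP_mem_delta_iff.1 hs
    rw [re_S_smul, le_div_iff₀ (re_sq_add_im_sq_pos w), zero_mul, neg_nonneg] at hre
    rcases re_eq_or_of_fixed_S_smul hp hodd hw hre h with hre₀ | hre₀ | hcirc
    · exact Or.inl (Or.inl (Or.inr ⟨_, (re_S_smul w).trans (by simp [hre₀]), rfl⟩))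
    · refine Or.inl (Or.inr (mem_lowerArc_iff.2 (Or.inr ⟨w, hre₀, hsqrt w.im_pos ?_ ?_, rfl⟩)))
      · norm_num
      · linarith [three_le_four_mul_im_sq hw]
    · obtain ⟨hre', him⟩ := S_smul_of_norm_add_one_eq_one hcirc
      refine Or.inr ((mem_verticalRay_iff (by positivity)).2
        (Or.inr ⟨S • w, hre', hsqrt (S • w).im_pos (by norm_num) ?_, rfl⟩))
      have hu := (abs_le.1 (abs_re_add_le_half hw (n := 1) (by simpa using hcirc))).1
      push_cast at hu
      have hle : 2 * -w.re ≤ 3 := by linarith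
      linarith [mul_le_mul_of_nonneg_right hle (by positivity : 0 ≤ 1 / 4 + (S • w).im ^ 2)]

lemma delta_eq (hp : IsPrimePow p) (hL : 2 * L + 1 = (p : ℤ)) :
    delta p = verticalRay 0 0 ∪ lowerArc p ∪ verticalRay (1 / 2) (√3 / 6) := by
  have hlt := hp.one_lt
  refine (delta_subset_union hp (odd_of_eq hL)).antisymm ?_
  refine union_subset (union_subset ?_ ?_) ?_
  · exact verticalRay_zero_subset_delta hp.pos
  · exact lowerArc_subset_delta hL
  · exact verticalRay_half_subset_delta (by omega)

lemma fixSet_eq (p : ℕ) :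
    fixSet (CongruenceSubgroup.Gamma0 p) (Xp p) = delta p ∪ sigma '' delta p := by
  have hσ {s : Sphere} (h : s ∈ fixSet (CongruenceSubgroup.Gamma0 p) (Xp p)) :
      sigma s ∈ fixSet (CongruenceSubgroup.Gamma0 p) (Xp p) := by
    rw [mem_fixSet_iff] at h ⊢
    exact ⟨sigma_mem_Xp h.1, h.2.sigma⟩
  have hsub {s : Sphere} (h : s ∈ delta p) : s ∈ fixSet (CongruenceSubgroup.Gamma0 p) (Xp p) :=
    ⟨h.1.1, h.2⟩
  refine Subset.antisymm (fun s hs ↦ ?_) ?_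
  · induction s using OnePoint.rec with
    | infty => exact Or.inl (infty_mem_delta p)
    | coe z =>
      rcases le_total 0 z.re with hz | hz
      · refine Or.inl ⟨⟨hs.1, fun w hw ↦ ?_⟩, hs.2⟩
        rwa [← OnePoint.coe_injective hw]
      · refine Or.inr ⟨_, ⟨⟨(hσ hs).1, fun w hw ↦ ?_⟩, (hσ hs).2⟩, sigma_involutive _⟩
        rw [← OnePoint.coe_injective hw]
        simpa using hz
  · rintro _ (h | ⟨s, h, rfl⟩)
    exacts [hsub h, hσ (hsub h)]

end

/-! ### Equivalent points of `δ` -/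

section
variable {p : ℕ} {L : ℤ}

lemma not_equiv₀_ofUHP {s : Sphere} (hs : s ∉ range ofUHP) (z : ℍ) : ¬Equiv₀ p s (ofUHP z) := by
  rintro ⟨γ, -, h⟩
  exact hs ⟨_, (moeb_eq_ofUHP_iff.1 h).symm⟩

lemma infty_notMem_range_ofUHP : ∞ ∉ range ofUHP := by
  rintro ⟨z, hz⟩
  exact ofUHP_ne_infty z hz

lemma zero_notMem_range_ofUHP : ((0 : ℂ) : OnePoint ℂ) ∉ range ofUHP := by
  rintro ⟨z, hz⟩
  exact ofUHP_ne_ofReal z 0 (by simpa using hz)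

lemma not_equiv₀_infty_zero (hp : 1 < p) : ¬Equiv₀ p ∞ ((0 : ℂ) : OnePoint ℂ) := by
  rintro ⟨γ, hγ, h⟩
  rw [mem_Gamma0_iff] at hγ
  have hdet := det_eq_one γ
  have ha : γ 0 0 = 0 := by
    rw [moeb_infty] at h
    split_ifs at h with hc
    · exact absurd h (OnePoint.infty_ne_coe _)
    · simpa [hc] using OnePoint.coe_injective h
  rw [ha, zero_mul, zero_sub] at hdet
  have : (p : ℤ) ∣ 1 := hdet ▸ (hγ.mul_left _).neg_right
  have := Int.le_of_dvd one_pos this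
  omega

/-- The part of `δ` in the upper half-plane that lies on the two vertical geodesics. -/
def deltaVertical : Set ℍ := {z | z.re = 0 ∨ z.re = 1 / 2 ∧ √3 / 6 ≤ z.im}

lemma re_of_mem_deltaVertical {z : ℍ} (hz : z ∈ deltaVertical) : z.re = 0 ∨ z.re = 1 / 2 :=
  hz.imp_right And.left

lemma mem_verticalRay_union_cases {s : Sphere}
    (hs : s ∈ verticalRay 0 0 ∪ verticalRay (1 / 2) (√3 / 6)) :
    s = ∞ ∨ s = ((0 : ℂ) : OnePoint ℂ) ∨ ∃ z ∈ deltaVertical, s = ofUHP z := by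
  rcases hs with hs | hs
  · rw [verticalRay_zero_zero] at hs
    rcases hs with (hs | hs) | ⟨z, hz, rfl⟩
    · exact Or.inr (Or.inl hs)
    · exact Or.inl hs
    · exact Or.inr (Or.inr ⟨z, Or.inl hz, rfl⟩)
  · refine ((mem_verticalRay_iff (by positivity)).1 hs).imp_right ?_
    rintro ⟨z, hre, him, rfl⟩
    exact Or.inr ⟨z, Or.inr ⟨hre, him⟩, rfl⟩

lemma mem_delta_cases (hp : IsPrimePow p) (hodd : Odd p) {s : Sphere} (hs : s ∈ delta p) :
    s = ∞ ∨ s = ((0 : ℂ) : OnePoint ℂ) ∨ (∃ z ∈ deltaVertical, s = ofUHP z) ∨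
      ∃ w : ℍ, w.re = -(p / 2) ∧ √3 / 2 ≤ w.im ∧ s = ofUHP (S • w) := by
  have hcases := delta_subset_union hp hodd hs
  rw [union_right_comm] at hcases
  rcases hcases with h | h
  · exact (mem_verticalRay_union_cases h).imp_right (Or.imp_right Or.inl)
  · exact Or.inr ((mem_lowerArc_iff.1 h).imp_right Or.inr)

lemma eq_vertex_of_equiv₀ (hp : 1 < p) (hL : 2 * L + 1 = (p : ℤ)) {z w : ℍ}
    (hz : z ∈ deltaVertical) (hre : w.re = -(p / 2)) (him : √3 / 2 ≤ w.im)
    (h : Equiv₀ p (ofUHP z) (ofUHP (S • w))) :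
    ofUHP z = vertex 1 ∧ ofUHP (S • w) = vertex L := by
  obtain ⟨v, hv, hv', hvertex⟩ := exists_vertex_one
  obtain ⟨u, hu, hu', hvertex'⟩ := exists_vertex_eq hL
  obtain ⟨z', hz', hz'', hglue⟩ := exists_equiv₀_S_smul hL hre
  obtain rfl := eq_of_equiv₀_of_re hp (odd_of_eq hL) (re_of_mem_deltaVertical hz) (Or.inr hz')
    (h.trans hglue)
  have hle : √3 / 6 ≤ z.im := (hz.resolve_left (by rw [hz']; norm_num)).2
  have hwim : w.im = √3 / 2 := by
    refine him.antisymm' ?_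
    rw [hz'', le_div_iff₀ (mul_pos four_pos w.im_pos)] at hle
    have h₃ := Real.mul_self_sqrt zero_le_three
    have : √3 * w.im ≤ √3 * (√3 / 2) := by linarith
    exact le_of_mul_le_mul_left this (by positivity)
  have hzim : z.im = √3 / 6 := by
    rw [hz'', hwim]
    field_simp
    norm_num
  rw [hvertex, hvertex',
    UpperHalfPlane.ext (Complex.ext (hz'.trans hv.symm) (hzim.trans hv'.symm)),
    UpperHalfPlane.ext (Complex.ext (hre.trans hu.symm) (hwim.trans hu'.symm))]
  exact ⟨rfl, rfl⟩

lemma eq_of_equiv₀_S_smul (hp : 1 < p) (hL : 2 * L + 1 = (p : ℤ)) {w w' : ℍ}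
    (hw : w.re = -(p / 2)) (hw' : w'.re = -(p / 2))
    (h : Equiv₀ p (ofUHP (S • w)) (ofUHP (S • w'))) : w = w' := by
  obtain ⟨z, hz, him, hglue⟩ := exists_equiv₀_S_smul hL hw
  obtain ⟨z', hz', him', hglue'⟩ := exists_equiv₀_S_smul hL hw'
  obtain rfl := eq_of_equiv₀_of_re hp (odd_of_eq hL) (Or.inr hz) (Or.inr hz')
    ((hglue.symm.trans h).trans hglue')
  refine UpperHalfPlane.ext (Complex.ext (hw.trans hw'.symm) ?_)
  have := him.symm.trans him'
  simpa using this

lemma eq_or_of_equiv₀ (hp : IsPrimePow p) (hL : 2 * L + 1 = (p : ℤ)) {s t : Sphere}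
    (hs : s ∈ delta p) (ht : t ∈ delta p) (h : Equiv₀ p s t) :
    s = t ∨ (s = vertex L ∧ t = vertex 1) ∨ (s = vertex 1 ∧ t = vertex L) := by
  have hodd := odd_of_eq hL
  have h₀ := not_equiv₀_infty_zero hp.one_lt
  have hinf := not_equiv₀_ofUHP (p := p) infty_notMem_range_ofUHP
  have hzero := not_equiv₀_ofUHP (p := p) zero_notMem_range_ofUHP
  rcases mem_delta_cases hp hodd hs with rfl | rfl | ⟨z, hz, rfl⟩ | ⟨w, hre, him, rfl⟩ <;>
    rcases mem_delta_cases hp hodd ht with rfl | rfl | ⟨z', hz', rfl⟩ | ⟨w', hre', him', rfl⟩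
  · exact Or.inl rfl
  · exact absurd h h₀
  · exact absurd h (hinf _)
  · exact absurd h (hinf _)
  · exact absurd h.symm h₀
  · exact Or.inl rfl
  · exact absurd h (hzero _)
  · exact absurd h (hzero _)
  · exact absurd h.symm (hinf _)
  · exact absurd h.symm (hzero _)
  · exact Or.inl (congrArg ofUHP (eq_of_equiv₀_of_re hp.one_lt hodd (re_of_mem_deltaVertical hz)
      (re_of_mem_deltaVertical hz') h))
  · exact Or.inr (Or.inr (eq_vertex_of_equiv₀ hp.one_lt hL hz hre' him' h))
  · exact absurd h.symm (hinf _)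
  · exact absurd h.symm (hzero _)
  · exact Or.inr (Or.inl (eq_vertex_of_equiv₀ hp.one_lt hL hz' hre him h.symm).symm)
  · exact Or.inl (congrArg (fun w ↦ ofUHP (S • w)) (eq_of_equiv₀_S_smul hp.one_lt hL hre hre' h))

lemma equiv₀_iff_of_mem_delta (hp : IsPrimePow p) (hL : 2 * L + 1 = (p : ℤ)) {s t : Sphere}
    (hs : s ∈ delta p) (ht : t ∈ delta p) : Equiv₀ p s t ↔
      s = t ∨ (s = vertex L ∧ t = vertex 1) ∨ (s = vertex 1 ∧ t = vertex L) := by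
  refine ⟨eq_or_of_equiv₀ hp hL hs ht, ?_⟩
  rintro (rfl | ⟨rfl, rfl⟩ | ⟨rfl, rfl⟩)
  exacts [Equiv₀.refl _, equiv₀_vertex hL, (equiv₀_vertex hL).symm]

end

/-! ### Curves -/

section Curves

variable {X : Type*} [TopologicalSpace X]

/-- `A` is a simple arc from `a` to `b`: it is traced by an injective path. -/
def IsArc (a b : X) (A : Set X) : Prop :=
  ∃ h : Path a b, Function.Injective h ∧ range h = A

lemma IsArc.symm {a b : X} {A : Set X} (h : IsArc a b A) : IsArc b a A := by
  obtain ⟨h, hinj, rfl⟩ := h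
  exact ⟨h.symm, hinj.comp unitInterval.symm_bijective.injective, h.symm_range⟩

lemma IsGeodesicArc.isArc {a b : Sphere} {A : Set Sphere} (h : IsGeodesicArc a b A) :
    IsArc a b A := by
  obtain ⟨h, hinj, hrange, -⟩ := h
  exact ⟨h, hinj, hrange⟩

lemma IsSimpleCurve.isArc {a b : X} {A : Set X} (h : IsSimpleCurve a b A) (hab : a ≠ b) :
    IsArc a b A := by
  obtain ⟨h, hrange, hsimple⟩ := h
  refine ⟨h, Function.Injective.of_lt_imp_ne fun s t hst he ↦ hab ?_, hrange⟩
  obtain ⟨rfl, rfl⟩ := hsimple s t hst he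
  rwa [h.source, h.target] at he

lemma IsArc.union {a b c : X} {A B : Set X} (hA : IsArc a b A) (hB : IsArc b c B)
    (h : ∀ x ∈ A, x ∈ B → x = b ∨ (x = a ∧ x = c)) : IsSimpleCurve a c (A ∪ B) := by
  obtain ⟨f, hf, rfl⟩ := hA
  obtain ⟨g, hg, rfl⟩ := hB
  refine ⟨f.trans g, Path.trans_range f g, fun s t hst he ↦ ?_⟩
  rw [Path.trans_apply, Path.trans_apply] at he
  have hlt : (s : ℝ) < t := hst
  split_ifs at he with hs ht ht
  · have hval : 2 * (s : ℝ) = 2 * t := congrArg Subtype.val (hf he)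
    linarith
  · rcases h _ ⟨_, rfl⟩ ⟨_, he.symm⟩ with hb | ⟨ha, hc⟩
    · have hval : 2 * (t : ℝ) - 1 = 0 :=
        congrArg Subtype.val (hg ((he.symm.trans hb).trans g.source.symm))
      linarith
    · have hval : 2 * (s : ℝ) = 0 := congrArg Subtype.val (hf (ha.trans f.source.symm))
      have hval' : 2 * (t : ℝ) - 1 = 1 :=
        congrArg Subtype.val (hg ((he.symm.trans hc).trans g.target.symm))
      exact ⟨Subtype.ext (by rw [Icc.coe_zero]; linarith),
        Subtype.ext (by rw [Icc.coe_one]; linarith)⟩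
  · linarith
  · have hval : 2 * (s : ℝ) - 1 = 2 * t - 1 := congrArg Subtype.val (hg he)
    linarith

/-- The standard parametrization `t ↦ exp (2 π i t)` of the circle by the unit interval; it
presents the circle as the interval with its end points glued. -/
noncomputable def circleLoop : C(unitInterval, Circle) where
  toFun t := Circle.exp (2 * Real.pi * t)
  continuous_toFun := by fun_prop

lemma circleLoop_eq_iff_of_lt {s t : unitInterval} (hst : s < t) :
    circleLoop s = circleLoop t ↔ s = 0 ∧ t = 1 := by
  constructor
  · intro h
    obtain ⟨m, hm⟩ := Circle.exp_eq_exp.1 h.symm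
    have hdiff : (t : ℝ) = s + m := by
      have hpi : 2 * Real.pi ≠ 0 := Real.two_pi_pos.ne'
      exact mul_left_cancel₀ hpi (by linear_combination hm)
    have hm0 : (0 : ℝ) < m := by linarith [show (s : ℝ) < t from hst]
    have hm1 : (1 : ℝ) ≤ m := by exact_mod_cast hm0
    have hs := s.2.1
    have ht := t.2.2
    exact ⟨Subtype.ext (by rw [Icc.coe_zero]; linarith),
      Subtype.ext (by rw [Icc.coe_one]; linarith)⟩
  · rintro ⟨rfl, rfl⟩
    simp [circleLoop]

lemma circleLoop_surjective : Function.Surjective circleLoop := by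
  intro z
  set x := Complex.arg z / (2 * Real.pi) with hx
  refine ⟨⟨Int.fract x, Int.fract_nonneg x, (Int.fract_lt_one x).le⟩, ?_⟩
  rw [← Circle.exp_arg z]
  refine Circle.exp_eq_exp.2 ⟨-⌊x⌋, ?_⟩
  have harg : Complex.arg z = 2 * Real.pi * x := by
    rw [hx]
    field_simp
  have hfract : Int.fract x = x - ⌊x⌋ := rfl
  push_cast
  linear_combination 2 * Real.pi * hfract - harg

lemma isQuotientMap_circleLoop : IsQuotientMap circleLoop :=
  circleLoop.continuous.isClosedMap.isQuotientMap circleLoop.continuous circleLoop_surjective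

lemma isSimpleClosedCurve_range {g : C(unitInterval, X)} (h01 : g 0 = g 1)
    (hinj : ∀ s t : unitInterval, s < t → g s = g t → s = 0 ∧ t = 1) (hcl : IsClosedMap g) :
    IsSimpleClosedCurve (range g) := by
  have hfactor : ∀ s t, circleLoop s = circleLoop t ↔ g s = g t := by
    have hlt : ∀ s t, s < t → (circleLoop s = circleLoop t ↔ g s = g t) := fun s t hst ↦ by
      rw [circleLoop_eq_iff_of_lt hst]
      exact ⟨by rintro ⟨rfl, rfl⟩; exact h01, hinj s t hst⟩
    intro s t
    rcases lt_trichotomy s t with hst | rfl | hts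
    · exact hlt s t hst
    · exact iff_of_true rfl rfl
    · rw [eq_comm, hlt t s hts, eq_comm]
  set f := isQuotientMap_circleLoop.lift g fun s t ↦ (hfactor s t).1
  have hfg : ∀ t, f (circleLoop t) = g t :=
    DFunLike.congr_fun (isQuotientMap_circleLoop.lift_comp g fun s t ↦ (hfactor s t).1)
  have hcomp : f ∘ circleLoop = g := funext hfg
  have hfinj : Function.Injective f := by
    intro x y hxy
    obtain ⟨s, rfl⟩ := circleLoop_surjective x
    obtain ⟨t, rfl⟩ := circleLoop_surjective y
    rwa [hfg, hfg, ← hfactor] at hxy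
  have hfcl : IsClosedMap f := by
    intro C hC
    rw [← image_preimage_eq C circleLoop_surjective, ← image_comp, hcomp]
    exact hcl _ (hC.preimage circleLoop.continuous)
  refine ⟨f, (IsClosedEmbedding.of_continuous_injective_isClosedMap f.continuous hfinj
    hfcl).isEmbedding, ?_⟩
  rw [← hcomp, circleLoop_surjective.range_comp]

end Curves

/-! ### Geodesics -/

/-- The point of the sphere with homogeneous coordinates `(n : d)`. -/
noncomputable def ratio (n d : ℂ) : Sphere := if d = 0 then ∞ else ((n / d : ℂ) : OnePoint ℂ)

section Continuity

variable {X : Type*} [TopologicalSpace X]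

lemma continuousAt_ratio_of_eq_zero {n d : X → ℂ} {x : X} (hn : ContinuousAt n x)
    (hd : ContinuousAt d x) (hnx : n x ≠ 0) (hdx : d x = 0) :
    ContinuousAt (fun y ↦ ratio (n y) (d y)) x := by
  rw [ContinuousAt, ratio, if_pos hdx, Tendsto, OnePoint.le_nhds_infty]
  intro s _ hs
  obtain ⟨R, hR⟩ := hs.isBounded.exists_norm_le
  have hlt : R * ‖d x‖ < ‖n x‖ := by
    rw [hdx, norm_zero, mul_zero]
    exact norm_pos_iff.2 hnx
  rw [mem_map]
  filter_upwards [(hd.norm.const_mul R).eventually_lt hn.norm hlt] with y hy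
  by_cases hdy : d y = 0
  · exact Or.inr (if_pos hdy)
  · refine Or.inl ⟨n y / d y, fun hmem ↦ ?_, (if_neg hdy).symm⟩
    have hle := hR _ hmem
    rw [norm_div, div_le_iff₀ (norm_pos_iff.2 hdy)] at hle
    exact hle.not_gt hy

lemma continuousAt_ratio {n d : X → ℂ} {x : X} (hn : ContinuousAt n x) (hd : ContinuousAt d x)
    (h : d x = 0 → n x ≠ 0) : ContinuousAt (fun y ↦ ratio (n y) (d y)) x := by
  by_cases hx : d x = 0
  · exact continuousAt_ratio_of_eq_zero hn hd (h hx) hx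
  · have hcoe : (fun y ↦ ((n y / d y : ℂ) : OnePoint ℂ)) =ᶠ[𝓝 x] fun y ↦ ratio (n y) (d y) := by
      filter_upwards [hd.eventually_ne hx] with y hy
      exact (if_neg hy).symm
    exact (OnePoint.continuous_coe.continuousAt.comp (hn.div hd hx)).congr hcoe

end Continuity

lemma moeb_infty_eq_ratio (γ : SL(2, ℤ)) : moeb γ ∞ = ratio (γ 0 0) (γ 1 0) := by
  rw [moeb_infty, ratio]
  norm_cast

lemma continuous_moeb (γ : SL(2, ℤ)) : Continuous (moeb γ) := by
  have hdet : (γ 0 0 : ℂ) * γ 1 1 - γ 0 1 * γ 1 0 = 1 := by exact_mod_cast det_eq_one γ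
  have hne : ∀ u v : ℂ, (γ 1 0 : ℂ) * u + γ 1 1 * v = 0 → (γ 0 0 : ℂ) * u + γ 0 1 * v = 0 →
      u = 0 ∧ v = 0 := fun u v h h' ↦
    ⟨by linear_combination γ 1 1 * h' - γ 0 1 * h - u * hdet,
      by linear_combination γ 0 0 * h - γ 1 0 * h' - v * hdet⟩
  rw [OnePoint.continuous_iff]
  constructor
  · have hcont : ContinuousAt
        (fun w : ℂ ↦ ratio (γ 0 0 + γ 0 1 * w) (γ 1 0 + γ 1 1 * w)) 0 := by
      refine continuousAt_ratio (by fun_prop) (by fun_prop) fun h h' ↦ one_ne_zero (α := ℂ) ?_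
      exact (hne 1 0 (by simpa using h) (by simpa using h')).1
    have hlim := hcont.tendsto.comp (tendsto_inv₀_cobounded (α := ℂ))
    rw [mul_zero, add_zero, mul_zero, add_zero, ← moeb_infty_eq_ratio] at hlim
    rw [coclosedCompact_eq_cocompact, ← Metric.cobounded_eq_cocompact]
    refine hlim.congr' ?_
    filter_upwards [Bornology.eventually_ne_cobounded (0 : ℂ)] with z hz
    have hmul : ∀ a b : ℂ, a + b * z⁻¹ = (a * z + b) / z := fun a b ↦ by
      field_simp [hz]
    rw [Function.comp_apply, hmul, hmul, moeb_coe, ratio, div_div_div_cancel_right₀ hz]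
    simp only [div_eq_zero_iff, hz, or_false]
  · have hratio : (fun z : ℂ ↦ moeb γ z) = fun z : ℂ ↦
        ratio ((γ 0 0 : ℂ) * z + γ 0 1) ((γ 1 0 : ℂ) * z + γ 1 1) := funext (moeb_coe γ)
    rw [hratio, continuous_iff_continuousAt]
    refine fun z ↦ continuousAt_ratio (by fun_prop) (by fun_prop) fun h h' ↦
      one_ne_zero (α := ℂ) ?_
    exact (hne z 1 (by simpa using h) (by simpa using h')).2

lemma IsGeodesicArc.symm {a b : Sphere} {A : Set Sphere} (h : IsGeodesicArc a b A) :
    IsGeodesicArc b a A := by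
  obtain ⟨h, hinj, rfl, hmem, hdist⟩ := h
  refine ⟨h.symm, hinj.comp unitInterval.symm_bijective.injective, h.symm_range,
    fun t h₀ h₁ ↦ hmem _ ?_ ?_, fun s t u x y z hst htu hx hy hz ↦ ?_⟩
  · exact unitInterval.symm_one ▸ unitInterval.strictAnti_symm h₁
  · exact unitInterval.symm_zero ▸ unitInterval.strictAnti_symm h₀
  · rw [dist_comm x z, dist_comm x y, dist_comm y z, add_comm]
    exact hdist _ _ _ z y x (unitInterval.strictAnti_symm.antitone htu)
      (unitInterval.strictAnti_symm.antitone hst) hz hy hx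

lemma IsGeodesicArc.moeb {a b : Sphere} {A : Set Sphere} (h : IsGeodesicArc a b A)
    (γ : SL(2, ℤ)) : IsGeodesicArc (moeb γ a) (moeb γ b) (moeb γ '' A) := by
  obtain ⟨h, hinj, rfl, hmem, hdist⟩ := h
  refine ⟨h.map (continuous_moeb γ), (moeb_injective γ).comp hinj,
    range_comp (GammaZeroFix.moeb γ) h, fun t h₀ h₁ ↦ ?_, fun s t u x y z hst htu hx hy hz ↦ ?_⟩
  · obtain ⟨z, hz⟩ := hmem t h₀ h₁
    exact ⟨γ • z, by rw [← moeb_ofUHP, hz]; rfl⟩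
  · have hadd := hdist s t u (γ⁻¹ • x) (γ⁻¹ • y) (γ⁻¹ • z) hst htu (moeb_eq_ofUHP_iff.1 hx)
      (moeb_eq_ofUHP_iff.1 hy) (moeb_eq_ofUHP_iff.1 hz)
    have hsmul : ∀ v w : ℍ, dist (γ⁻¹ • v) (γ⁻¹ • w) = dist v w :=
      fun v w ↦ dist_smul ((γ⁻¹ : SL(2, ℤ)) : SL(2, ℝ)) v w
    rwa [hsmul, hsmul, hsmul] at hadd

lemma dist_add_dist_of_re_eq {x y z : ℍ} (hxy : x.re = y.re) (hyz : y.re = z.re)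
    (hxy' : x.im ≤ y.im) (hyz' : y.im ≤ z.im) : dist x z = dist x y + dist y z := by
  have hlog := Real.log_le_log x.im_pos hxy'
  have hlog' := Real.log_le_log y.im_pos hyz'
  rw [UpperHalfPlane.dist_of_re_eq (hxy.trans hyz), UpperHalfPlane.dist_of_re_eq hxy,
    UpperHalfPlane.dist_of_re_eq hyz, Real.dist_eq, Real.dist_eq, Real.dist_eq,
    abs_of_nonpos (by linarith), abs_of_nonpos (by linarith), abs_of_nonpos (by linarith)]
  ring

section VerticalRay

variable {r α t : ℝ}

/-- A parametrization of the heights on a vertical ray: it increases from `α` at `t = 0` and tends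
to infinity at `t = 1`, where the division only gives the value `0`. -/
noncomputable def rayHeight (α t : ℝ) : ℝ := (α + t) / (1 - t)

lemma rayHeight_zero (α : ℝ) : rayHeight α 0 = α := by simp [rayHeight]

lemma strictMonoOn_rayHeight (hα : 0 ≤ α) : StrictMonoOn (rayHeight α) (Iio 1) := by
  intro s hs t ht hst
  rw [rayHeight, rayHeight, div_lt_div_iff₀ (sub_pos.2 hs) (sub_pos.2 ht)]
  nlinarith

lemma exists_rayHeight_eq (hα : 0 ≤ α) {y : ℝ} (hy : α ≤ y) :
    ∃ t : unitInterval, t < 1 ∧ rayHeight α t = y := by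
  have hpos : 0 < y + 1 := by linarith
  have hlt : (y - α) / (y + 1) < 1 := (div_lt_one hpos).2 (by linarith)
  refine ⟨⟨(y - α) / (y + 1), div_nonneg (by linarith) hpos.le, hlt.le⟩, hlt, ?_⟩
  rw [rayHeight, div_eq_iff (sub_pos.2 hlt).ne']
  field_simp
  ring

/-- The parametrization by `t ∈ [0, 1]` of the vertical ray from `r + i α` to the cusp at infinity
whose point at `t < 1` has height `rayHeight α t`. -/
noncomputable def rayParam (r α t : ℝ) : Sphere :=
  ratio ((1 - t : ℝ) * r + (α + t : ℝ) * Complex.I) (1 - t : ℝ)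

lemma rayParam_one (r α : ℝ) : rayParam r α 1 = ∞ := if_pos (by simp)

lemma rayParam_of_lt_one (r α : ℝ) (ht : t < 1) :
    rayParam r α t = ((⟨r, rayHeight α t⟩ : ℂ) : OnePoint ℂ) := by
  have hne : ((1 - t : ℝ) : ℂ) ≠ 0 := Complex.ofReal_ne_zero.2 (sub_pos.2 ht).ne'
  rw [rayParam, ratio, if_neg hne, Complex.mk_eq_add_mul_I, rayHeight, Complex.ofReal_div]
  congr 1
  field_simp

lemma continuous_rayParam (r : ℝ) (hα : 0 ≤ α) : Continuous (rayParam r α) := by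
  refine continuous_iff_continuousAt.2 fun t ↦ continuousAt_ratio (by fun_prop) (by fun_prop) ?_
  intro h
  have ht : t = 1 := (sub_eq_zero.1 (Complex.ofReal_eq_zero.1 h)).symm
  have hα₁ : α + 1 ≠ 0 := by positivity
  simpa [ht] using mod_cast hα₁

lemma rayParam_eq_ofUHP {w : ℍ} (ht : t ≤ 1) (h : rayParam r α t = ofUHP w) :
    t < 1 ∧ w.re = r ∧ w.im = rayHeight α t := by
  rcases ht.eq_or_lt with rfl | ht
  · exact absurd ((rayParam_one r α).symm.trans h).symm (ofUHP_ne_infty w)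
  · rw [rayParam_of_lt_one r α ht] at h
    have hcoe := OnePoint.coe_injective h
    exact ⟨ht, (congrArg Complex.re hcoe).symm, (congrArg Complex.im hcoe).symm⟩

lemma range_rayParam (r : ℝ) (hα : 0 ≤ α) :
    range (fun t : unitInterval ↦ rayParam r α t) = verticalRay r α := by
  ext s
  constructor
  · rintro ⟨t, rfl⟩
    rcases t.2.2.eq_or_lt with ht | ht
    · exact Or.inl ((congrArg _ ht).trans (rayParam_one r α))
    · have hle := (strictMonoOn_rayHeight hα).monotoneOn (mem_Iio.2 one_pos) ht t.2.1
      rw [rayHeight_zero] at hle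
      exact Or.inr ⟨_, hle, (rayParam_of_lt_one r α ht).symm⟩
  · rintro (rfl | ⟨y, hy, rfl⟩)
    · exact ⟨1, rayParam_one r α⟩
    · obtain ⟨t, ht, rfl⟩ := exists_rayHeight_eq hα hy
      exact ⟨t, rayParam_of_lt_one r α ht⟩

lemma injective_rayParam (r : ℝ) (hα : 0 ≤ α) :
    Function.Injective fun t : unitInterval ↦ rayParam r α t := by
  refine Function.Injective.of_lt_imp_ne fun s t hst heq ↦ ?_
  have hs : (s : ℝ) < 1 := (show (s : ℝ) < t from hst).trans_le t.2.2
  rw [rayParam_of_lt_one r α hs] at heq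
  rcases t.2.2.eq_or_lt with ht | ht
  · rw [ht, rayParam_one] at heq
    exact OnePoint.coe_ne_infty _ heq
  · rw [rayParam_of_lt_one r α ht] at heq
    exact (strictMonoOn_rayHeight hα hs ht hst).ne
      (congrArg Complex.im (OnePoint.coe_injective heq))

lemma isGeodesicArc_verticalRay (r : ℝ) (hα : 0 ≤ α) :
    IsGeodesicArc ((⟨r, α⟩ : ℂ) : OnePoint ℂ) ∞ (verticalRay r α) := by
  have hmono := (strictMonoOn_rayHeight hα).monotoneOn
  refine ⟨⟨⟨fun t ↦ rayParam r α t, (continuous_rayParam r hα).comp continuous_subtype_val⟩,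
    ?_, rayParam_one r α⟩, injective_rayParam r hα, range_rayParam r hα, fun t h₀ h₁ ↦ ?_,
    fun s t u x y z hst htu hx hy hz ↦ ?_⟩
  · exact (rayParam_of_lt_one r α one_pos).trans (by rw [rayHeight_zero])
  · have hpos := strictMonoOn_rayHeight hα (mem_Iio.2 one_pos) h₁ h₀
    rw [rayHeight_zero] at hpos
    exact ⟨⟨⟨r, rayHeight α t⟩, hα.trans_lt hpos⟩, (rayParam_of_lt_one r α h₁).symm⟩
  · obtain ⟨hs, hxre, hxim⟩ := rayParam_eq_ofUHP s.2.2 hx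
    obtain ⟨ht, hyre, hyim⟩ := rayParam_eq_ofUHP t.2.2 hy
    obtain ⟨hu, hzre, hzim⟩ := rayParam_eq_ofUHP u.2.2 hz
    refine dist_add_dist_of_re_eq (hxre.trans hyre.symm) (hyre.trans hzre.symm) ?_ ?_
    · rw [hxim, hyim]
      exact hmono hs ht hst
    · rw [hyim, hzim]
      exact hmono ht hu htu

end VerticalRay

lemma isCompleteGeodesic_verticalLine (r : ℝ) :
    IsCompleteGeodesic ((r : ℂ) : OnePoint ℂ) ∞ (verticalLine r) := by
  have hcoe : ∀ t : ℝ, (⟨r, Real.exp t⟩ : ℂ) = r + (Real.exp t : ℂ) * Complex.I := fun t ↦ by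
    rw [Complex.mk_eq_add_mul_I, Complex.ofReal_exp]
  refine ⟨_, UpperHalfPlane.isometry_vertical_line r, ?_, ?_, ?_⟩
  · ext s
    constructor
    · rintro ⟨t, rfl⟩
      exact ⟨_, rfl, rfl⟩
    · rintro ⟨z, hz, rfl⟩
      exact ⟨Real.log z.im,
        congrArg _ (UpperHalfPlane.ext (Complex.ext hz.symm (Real.exp_log z.im_pos)))⟩
  · have hlim : Tendsto (fun t : ℝ ↦ (⟨r, Real.exp t⟩ : ℂ)) atBot (𝓝 r) := by
      have hexp := Complex.continuous_ofReal.continuousAt.tendsto.comp Real.tendsto_exp_atBot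
      simpa [hcoe] using (hexp.mul_const Complex.I).const_add (r : ℂ)
    exact (OnePoint.continuous_coe.tendsto _).comp hlim
  · refine OnePoint.tendsto_coe_infty.comp (f := fun t : ℝ ↦ (⟨r, Real.exp t⟩ : ℂ)) ?_
    rw [coclosedCompact_eq_cocompact, ← Metric.cobounded_eq_cocompact,
      ← tendsto_norm_atTop_iff_cobounded]
    exact tendsto_atTop_mono (fun t ↦ (le_abs_self _).trans (Complex.abs_im_le_norm _))
      Real.tendsto_exp_atTop

/-! ### The curve `δ` and its image on the glued surface -/

section
variable {p : ℕ} {L : ℤ}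

lemma isGeodesicArc_lowerArc (hL : 2 * L + 1 = (p : ℤ)) :
    IsGeodesicArc ((0 : ℂ) : OnePoint ℂ) (vertex L) (lowerArc p) := by
  have h := (isGeodesicArc_verticalRay (-(p / 2)) (by positivity : 0 ≤ √3 / 2)).moeb S
  rw [moeb_S_infty, ← vertex_eq hL] at h
  exact h.symm

lemma isGeodesicArc_verticalRay_half :
    IsGeodesicArc (vertex 1) ∞ (verticalRay (1 / 2) (√3 / 6)) :=
  vertex_one ▸ isGeodesicArc_verticalRay (1 / 2) (by positivity)

lemma isArc_verticalRay_union : IsArc ((0 : ℂ) : OnePoint ℂ) (vertex 1)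
    (verticalRay 0 0 ∪ verticalRay (1 / 2) (√3 / 6)) := by
  refine IsSimpleCurve.isArc ((isGeodesicArc_verticalRay 0 le_rfl).isArc.union
    isGeodesicArc_verticalRay_half.isArc.symm ?_) ?_
  · rintro _ (rfl | ⟨y, -, rfl⟩) (h | ⟨y', -, h⟩)
    · exact Or.inl rfl
    · exact Or.inl rfl
    · exact Or.inl h
    · have hre := congrArg Complex.re (OnePoint.coe_injective h)
      norm_num at hre
  · obtain ⟨z, -, -, hz⟩ := exists_vertex_one
    rw [hz]
    exact fun h ↦ zero_notMem_range_ofUHP ⟨z, h.symm⟩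

lemma isSimpleCurve_delta (hp : IsPrimePow p) (hL : 2 * L + 1 = (p : ℤ)) :
    IsSimpleCurve (vertex L) (vertex 1) (delta p) := by
  rw [delta_eq hp hL, union_right_comm, union_comm]
  refine (isGeodesicArc_lowerArc hL).isArc.symm.union isArc_verticalRay_union fun s hs hs' ↦ ?_
  refine (mem_lowerArc_iff.1 hs).imp_right ?_
  rintro ⟨w, hre, him, rfl⟩
  rcases mem_verticalRay_union_cases hs' with h | h | ⟨z, hz, h⟩
  · exact absurd h (ofUHP_ne_infty _)
  · exact absurd ⟨_, h⟩ zero_notMem_range_ofUHP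
  · have hvertex := eq_vertex_of_equiv₀ hp.one_lt hL hz hre him (h ▸ Equiv₀.refl _)
    exact ⟨hvertex.2, h.trans hvertex.1⟩

lemma mem_delta_or_sigma_mem_delta {z : Sphere}
    (hz : z ∈ fixSet (CongruenceSubgroup.Gamma0 p) (Xp p)) : z ∈ delta p ∨ sigma z ∈ delta p := by
  rw [fixSet_eq] at hz
  refine hz.imp_right ?_
  rintro ⟨w, hw, rfl⟩
  rwa [sigma_involutive]

lemma delta_subset_fixSet (p : ℕ) :
    delta p ⊆ fixSet (CongruenceSubgroup.Gamma0 p) (Xp p) :=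
  fixSet_eq p ▸ subset_union_left

lemma proj_eq_iff {z w : Xp p} : proj p z = proj p w ↔ Equiv₀ p z w := Quotient.eq

lemma proj_mem_fixTilde {z : Xp p} (hz : (z : Sphere) ∈ delta p) : proj p z ∈ fixTilde p :=
  ⟨z, delta_subset_fixSet p hz, rfl⟩

lemma fixTilde_eq_glue_delta (p : ℕ) : fixTilde p = glue p (delta p) := by
  refine Subset.antisymm ?_ ?_
  · rintro _ ⟨z, hz, rfl⟩
    rcases mem_delta_or_sigma_mem_delta hz with h | h
    · exact ⟨z, h, rfl⟩
    · exact ⟨⟨sigma z, h.1.1⟩, h, proj_eq_iff.2 (mem_fixSet_iff.1 hz).2.symm⟩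
  · rintro _ ⟨z, hz, rfl⟩
    exact proj_mem_fixTilde hz

lemma isClosed_saturation_inter_delta (hp : IsPrimePow p) (hL : 2 * L + 1 = (p : ℤ))
    {K : Set Sphere} (hK : K ⊆ delta p) (hKc : IsClosed K) :
    IsClosed {z ∈ delta p | ∃ w ∈ K, Equiv₀ p w z} := by
  set K' := {z ∈ delta p | ∃ w ∈ K, Equiv₀ p w z}
  have hKK' : K ⊆ K' := fun z hz ↦ ⟨hK hz, z, hz, Equiv₀.refl z⟩
  have hfin : K' \ K ⊆ {vertex 1, vertex L} := by
    rintro z ⟨⟨hz, w, hw, h⟩, hzK⟩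
    rcases (equiv₀_iff_of_mem_delta hp hL (hK hw) hz).1 h with rfl | ⟨-, rfl⟩ | ⟨-, rfl⟩
    · exact absurd hw hzK
    · exact Or.inl rfl
    · exact Or.inr rfl
  rw [← union_sdiff_cancel hKK']
  exact hKc.union ((toFinite _).subset hfin).isClosed

lemma isClosed_saturation (hp : IsPrimePow p) (hL : 2 * L + 1 = (p : ℤ)) {K : Set Sphere}
    (hK : K ⊆ delta p) (hKc : IsClosed K) : IsClosed {z : Xp p | ∃ w ∈ K, Equiv₀ p w z} := by
  set K' := {z ∈ delta p | ∃ w ∈ K, Equiv₀ p w z}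
  have hK' : IsClosed K' := isClosed_saturation_inter_delta hp hL hK hKc
  have heq : {z : Xp p | ∃ w ∈ K, Equiv₀ p w z} = Subtype.val ⁻¹' (K' ∪ sigma ⁻¹' K') := by
    ext z
    constructor
    · rintro ⟨w, hw, h⟩
      have hfix := Equiv₀.fixed h.symm (mem_fixSet_iff.1 (hK hw)).2
      exact (mem_delta_or_sigma_mem_delta (mem_fixSet_iff.2 ⟨z.2, hfix⟩)).imp
        (fun hz ↦ ⟨hz, w, hw, h⟩) fun hz ↦ ⟨hz, w, hw, h.trans hfix⟩
    · rintro (⟨-, h⟩ | ⟨hz, w, hw, h⟩)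
      · exact h
      · have hfix := (mem_fixSet_iff.1 hz).2
        rw [sigma_involutive] at hfix
        exact ⟨w, hw, h.trans hfix⟩
  rw [heq]
  exact (hK'.union (hK'.preimage continuous_sigma)).preimage continuous_subtype_val

lemma eq_zero_and_eq_one_of_glued {X : Type*} {h : unitInterval → X}
    (hsimple : ∀ s t, s < t → h s = h t → s = 0 ∧ t = 1) {s t : unitInterval} (hst : s < t)
    (hglued : h s = h t ∨ (h s = h 0 ∧ h t = h 1) ∨ (h s = h 1 ∧ h t = h 0)) :
    s = 0 ∧ t = 1 := by
  have hs : s < 1 := hst.trans_le unitInterval.le_one'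
  have ht : 0 < t := unitInterval.nonneg'.trans_lt hst
  rcases hglued with heq | ⟨hs₀, ht₁⟩ | ⟨hs₁, ht₀⟩
  · exact hsimple s t hst heq
  · refine ⟨by_contra fun hne ↦ ?_, by_contra fun hne ↦ ?_⟩
    · exact hs.ne (hsimple 0 s (unitInterval.pos_iff_ne_zero.2 hne) hs₀.symm).2
    · exact ht.ne' (hsimple t 1 (unitInterval.lt_one_iff_ne_one.2 hne) ht₁).1
  · exact ⟨(hsimple s 1 hs hs₁).1, (hsimple 0 t ht ht₀.symm).2⟩

lemma isSimpleClosedCurve_fixTilde (hp : IsPrimePow p) (hL : 2 * L + 1 = (p : ℤ)) :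
    IsSimpleClosedCurve (fixTilde p) := by
  obtain ⟨h, hrange, hsimple⟩ := isSimpleCurve_delta hp hL
  have hmem : ∀ t, h t ∈ delta p := fun t ↦ hrange ▸ mem_range_self t
  let g : C(unitInterval, XpTilde p) :=
    ⟨fun t ↦ proj p ⟨h t, (hmem t).1.1⟩, continuous_quotient_mk'.comp (h.continuous.subtype_mk _)⟩
  have hg : ∀ {s t}, g s = g t ↔ Equiv₀ p (h s) (h t) := proj_eq_iff
  have hfix : fixTilde p = range g := by
    rw [fixTilde_eq_glue_delta]
    ext x
    constructor
    · rintro ⟨z, hz, rfl⟩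
      obtain ⟨t, ht⟩ := hrange ▸ hz
      exact ⟨t, congrArg (proj p) (Subtype.ext ht)⟩
    · rintro ⟨t, rfl⟩
      exact ⟨_, hmem t, rfl⟩
  rw [hfix]
  refine isSimpleClosedCurve_range (hg.2 ?_) (fun s t hst heq ↦ ?_) fun C hC ↦ ?_
  · rw [h.source, h.target]
    exact equiv₀_vertex hL
  · refine eq_zero_and_eq_one_of_glued hsimple hst ?_
    rw [h.source, h.target]
    exact (equiv₀_iff_of_mem_delta hp hL (hmem s) (hmem t)).1 (hg.1 heq)
  · have hpre : proj p ⁻¹' (g '' C) = {z : Xp p | ∃ w ∈ h '' C, Equiv₀ p w z} := by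
      ext z
      exact (exists_congr fun t ↦ and_congr_right fun _ ↦ proj_eq_iff).trans
        (exists_mem_image (p := fun w ↦ Equiv₀ p w z)).symm
    refine isQuotientMap_quotient_mk'.isClosed_preimage.1 (hpre ▸ isClosed_saturation hp hL ?_ ?_)
    · rintro _ ⟨t, -, rfl⟩
      exact hmem t
    · exact (hC.isCompact.image h.continuous).isClosed

end

end GammaZeroFix

open GammaZeroFix in
theorem lemma6p1_general (p : ℕ) (hp : IsPrimePow p) (L : ℤ) (hL : 2 * L + 1 = (p : ℤ)) :
    (IsSimpleCurve (vertex L) (vertex 1) (delta p) ∧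
      (∃ A₁ A₂ A₃ : Set Sphere,
        IsGeodesicArc ((0 : ℂ) : OnePoint ℂ) ∞ A₁ ∧
        A₁ = {((0 : ℂ) : OnePoint ℂ), ∞} ∪ verticalLine 0 ∧
        IsGeodesicArc ((0 : ℂ) : OnePoint ℂ) (vertex L) A₂ ∧
        IsGeodesicArc (vertex 1) ∞ A₃ ∧
        A₃ ⊆ {∞} ∪ verticalLine (1 / 2) ∧
        delta p = A₁ ∪ A₂ ∪ A₃) ∧
      fixSet (CongruenceSubgroup.Gamma0 p) (Xp p) = delta p ∪ sigma '' delta p) ∧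
    (IsSimpleClosedCurve (fixTilde p) ∧
      (∃ x : Xp p, (x : Sphere) = ∞ ∧ proj p x ∈ fixTilde p) ∧
      Equiv₀ p (vertex L) (vertex 1) ∧
      fixTilde p = glue p (delta p) ∧
      (∀ z ∈ delta p, ∀ w ∈ delta p, Equiv₀ p z w ↔
        z = w ∨ (z = vertex L ∧ w = vertex 1) ∨ (z = vertex 1 ∧ w = vertex L))) ∧
    (IsCompleteGeodesic ((0 : ℂ) : OnePoint ℂ) ∞ (verticalLine 0) ∧
      IsCompleteGeodesic ((1 / 2 : ℂ) : OnePoint ℂ) ∞ (verticalLine (1 / 2)) ∧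
      orbitMap p '' fixSet (CongruenceSubgroup.Gamma0 p) (range ofUHP) =
        orbitMap p '' verticalLine 0 ∪ orbitMap p '' verticalLine (1 / 2) ∧
      (∀ γ ∈ CongruenceSubgroup.Gamma0 p,
        moeb γ '' verticalLine 0 ≠ verticalLine (1 / 2)) ∧
      InjOn (orbitMap p) (verticalLine 0 ∪ verticalLine (1 / 2)) ∧
      Equiv₀ p ((0 : ℂ) : OnePoint ℂ) ((1 / 2 : ℂ) : OnePoint ℂ)) := by
  have hodd : Odd p := odd_of_eq hL
  refine ⟨⟨isSimpleCurve_delta hp hL, ?_, fixSet_eq p⟩, ⟨isSimpleClosedCurve_fixTilde hp hL,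
    ⟨⟨∞, (infty_mem_delta p).1.1⟩, rfl, proj_mem_fixTilde (infty_mem_delta p)⟩, equiv₀_vertex hL,
    fixTilde_eq_glue_delta p, fun z hz w hw ↦ equiv₀_iff_of_mem_delta hp hL hz hw⟩,
    by simpa using isCompleteGeodesic_verticalLine 0,
    by simpa using isCompleteGeodesic_verticalLine (1 / 2), image_orbitMap_fixSet hp hodd,
    fun γ hγ ↦ moeb_image_verticalLine_ne hp.one_lt hodd hγ, injOn_orbitMap hp.one_lt hodd,
    equiv₀_zero_half hL⟩
  exact ⟨verticalRay 0 0, lowerArc p, verticalRay (1 / 2) (√3 / 6),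
    isGeodesicArc_verticalRay 0 le_rfl, verticalRay_zero_zero, isGeodesicArc_lowerArc hL,
    isGeodesicArc_verticalRay_half, verticalRay_subset (by positivity), delta_eq hp hL⟩

open GammaZeroFix in
theorem lemma6p1 (p : ℕ) (hp : p.Prime) (hp2 : p ≠ 2) (L : ℤ) (hL : 2 * L + 1 = (p : ℤ)) :
    -- (i)
    (IsSimpleCurve (vertex L) (vertex 1) (delta p) ∧
      (∃ A₁ A₂ A₃ : Set Sphere,
        IsGeodesicArc ((0 : ℂ) : OnePoint ℂ) ∞ A₁ ∧
        A₁ = {((0 : ℂ) : OnePoint ℂ), ∞} ∪ verticalLine 0 ∧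
        IsGeodesicArc ((0 : ℂ) : OnePoint ℂ) (vertex L) A₂ ∧
        IsGeodesicArc (vertex 1) ∞ A₃ ∧
        A₃ ⊆ {∞} ∪ verticalLine (1 / 2) ∧
        delta p = A₁ ∪ A₂ ∪ A₃) ∧
      fixSet (CongruenceSubgroup.Gamma0 p) (Xp p) = delta p ∪ sigma '' delta p) ∧
    -- (ii)
    (IsSimpleClosedCurve (fixTilde p) ∧
      (∃ x : Xp p, (x : Sphere) = ∞ ∧ proj p x ∈ fixTilde p) ∧
      Equiv₀ p (vertex L) (vertex 1) ∧
      fixTilde p = glue p (delta p) ∧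
      (∀ z ∈ delta p, ∀ w ∈ delta p, Equiv₀ p z w ↔
        z = w ∨ (z = vertex L ∧ w = vertex 1) ∨ (z = vertex 1 ∧ w = vertex L))) ∧
    -- (iii)
    (IsCompleteGeodesic ((0 : ℂ) : OnePoint ℂ) ∞ (verticalLine 0) ∧
      IsCompleteGeodesic ((1 / 2 : ℂ) : OnePoint ℂ) ∞ (verticalLine (1 / 2)) ∧
      orbitMap p '' fixSet (CongruenceSubgroup.Gamma0 p) (range ofUHP) =
        orbitMap p '' verticalLine 0 ∪ orbitMap p '' verticalLine (1 / 2) ∧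
      (∀ γ ∈ CongruenceSubgroup.Gamma0 p,
        moeb γ '' verticalLine 0 ≠ verticalLine (1 / 2)) ∧
      InjOn (orbitMap p) (verticalLine 0 ∪ verticalLine (1 / 2)) ∧
      Equiv₀ p ((0 : ℂ) : OnePoint ℂ) ((1 / 2 : ℂ) : OnePoint ℂ)) :=
  lemma6p1_general p hp.isPrimePow L hL
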